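/- Let \(k\) be a field of characteristic zero and let \(H\) be a Hopf algebra over \(k\) with antipode \(S\). Assume that \(H\) is pointed (every simple subcoalgebra of \(H\) is one-dimensional) and that the group \(G\) of grouplike elements of \(H\) is finite. We use Sweedler notation. A partial representation of \(H\) on a \(k\)-algebra \(B\) is a linear map \(\pi : H \to B\) with \(\pi(1)=1\), \(\pi(h)\pi(x_{(1)})\pi(S(x_{(2)}))=\pi(hx_{(1)})\pi(S(x_{(2)}))\) and \(\pi(h_{(1)})\pi(S(h_{(2)}))\pi(x)=\pi(h_{(1)})\pi(S(h_{(2)})x)\) for all \(h,x\in H\). A partial \(H\)-module is a vector space \(M\) with a partial representation of \(H\) on \(\mathrm{End}_k(M)\), written \(h\bullet m\); morphisms are the linear maps that commute with \(\bullet\). Let \([-]:H\to H_{par}\) be the universal partial representation, so that every partial module is an \(H_{par}\)-module, and let \(A_{par}\subseteq H_{par}\) be the subalgebra generated by the elements \(\varepsilon_h=[h_{(1)}][S(h_{(2)})]\). It is a partial \(H\)-module by \(h\bullet a=[h_{(1)}]\,a\,[S(h_{(2)})]\), and it acts on every partial module \(M\) (written \(a\cdot m\)) by restriction of the \(H_{par}\)-action.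 The space \(A_{par}\otimes H\) is a partial \(H\)-module by \(h\bullet(a\otimes x)=h_{(1)}\bullet a\otimes h_{(2)}x\). For a partial \(H\)-module \(M\), let \(\overline M\) be the \(H\)-module underlying its standard dilation: with \((h\rightharpoonup f)(x)=f(xh)\) on \(\mathrm{Hom}_k(H,M)\) and \(\varphi(m)(h)=h\bullet m\), it is the \(H\)-submodule of \(\mathrm{Hom}_k(H,M)\) generated by \(\varphi(M)\). Let \(\{A_{par},M\}\) be the space of morphisms of partial modules \(A_{par}\otimes H\to M\), an \(H\)-module by \((h\rightharpoonup f)(a\otimes x)=f(a\otimes xh)\). Let \(D : M\mapsto\overline M\) and \(\{A_{par},-\} : M\mapsto\{A_{par},M\}\) be the resulting functors from partial \(H\)-modules to \(H\)-modules, both acting on morphisms by composition, and let \(\Xi : D\Rightarrow\{A_{par},-\}\) be the natural transformation \[\Xi_M\Bigl(\sum_i h_i\rightharpoonup\varphi(m_i)\Bigr)(a\otimes x)=a\cdot\sum_i (xh_i\bullet m_i).\] Then \(\Xi\) is a natural isomorphism, so \(D\cong\{A_{par},-\}\). In particular, for every partial \(H\)-module \(M\), the map \(\Xi_M:\overline M\to\{A_{par},M\}\)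 is an isomorphism of \(H\)-modules. -/

import Mathlib

open TensorProduct Coalgebra

universe u v w w' w''

noncomputable section

namespace PartialHopf

section Convolution

variable {k C B : Type*} [CommRing k] [AddCommGroup C] [Module k C] [Coalgebra k C]
  [Ring B] [Algebra k B]

/-- The convolution product `c ↦ f c₍₁₎ * g c₍₂₎` of linear maps from a coalgebra to an algebra. -/
def conv (f g : C →ₗ[k] B) : C →ₗ[k] B :=
  LinearMap.mul' k B ∘ₗ TensorProduct.map f g ∘ₗ comul

local infixl:70 " ⋆ " => conv

/-- The map `c ↦ ε(c) b`. -/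
def cst (b : B) : C →ₗ[k] B := (LinearMap.toSpanSingleton k B b) ∘ₗ counit

theorem conv_eq (f g : C →ₗ[k] B) :
    f ⋆ g = (WithConv.toConv f * WithConv.toConv g).ofConv := rfl

theorem conv_repr (f g : C →ₗ[k] B) {ι : Type*} {c : C} (r : Repr k c ι) :
    (f ⋆ g) c = ∑ i ∈ r.index, f (r.left i) * g (r.right i) :=
  r.convMul_apply _ _

theorem conv_assoc (f g h : C →ₗ[k] B) : f ⋆ g ⋆ h = f ⋆ (g ⋆ h) := by
  have := mul_assoc (WithConv.toConv f) (WithConv.toConv g) (WithConv.toConv h)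
  exact congrArg WithConv.ofConv this

theorem cst_conv (b : B) (f : C →ₗ[k] B) : cst b ⋆ f = LinearMap.mulLeft k b ∘ₗ f := by
  ext c
  have h1 := rTensor_counit_comul (R := k) c
  rw [← (ℛ k c).eq] at h1
  have h2 := congrArg (TensorProduct.lift ((LinearMap.mul k B ∘ₗ
    LinearMap.toSpanSingleton k B b).compl₂ f)) h1
  simp only [map_sum, lift.tmul, LinearMap.rTensor_tmul,
    LinearMap.compl₂_apply, LinearMap.comp_apply, LinearMap.mul_apply', one_smul,
    LinearMap.toSpanSingleton_apply] at h2
  rw [conv_repr _ _ (ℛ k c)]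
  exact h2

theorem conv_cst (b : B) (f : C →ₗ[k] B) : f ⋆ cst b = LinearMap.mulRight k b ∘ₗ f := by
  ext c
  have h1 := lTensor_counit_comul (R := k) c
  rw [← (ℛ k c).eq] at h1
  have h2 := congrArg (TensorProduct.lift ((LinearMap.mul k B ∘ₗ f).compl₂
    (LinearMap.toSpanSingleton k B b))) h1
  simp only [map_sum, lift.tmul, LinearMap.lTensor_tmul,
    LinearMap.compl₂_apply, LinearMap.comp_apply, LinearMap.mul_apply', one_smul,
    LinearMap.toSpanSingleton_apply] at h2
  rw [conv_repr _ _ (ℛ k c)]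
  exact h2

theorem cst_one_conv (f : C →ₗ[k] B) : cst 1 ⋆ f = f := by
  rw [cst_conv]; ext; simp

theorem conv_cst_one (f : C →ₗ[k] B) : f ⋆ cst 1 = f := by
  rw [conv_cst]; ext; simp

theorem algHom_comp_conv {B' : Type*} [Ring B'] [Algebra k B'] (φ : B →ₐ[k] B')
    (f g : C →ₗ[k] B) :
    φ.toLinearMap ∘ₗ (f ⋆ g) = (φ.toLinearMap ∘ₗ f) ⋆ (φ.toLinearMap ∘ₗ g) := by
  ext c
  simp [conv_repr _ _ (ℛ k c)]

theorem conv_comp {D : Type*} [AddCommGroup D] [Module k D] [Coalgebra k D] (f g : C →ₗ[k] B)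
    (c : D →ₗc[k] C) :
    (f ⋆ g) ∘ₗ c.toLinearMap = (f ∘ₗ c.toLinearMap) ⋆ (g ∘ₗ c.toLinearMap) := by
  have := LinearMap.convMul_comp_coalgHom_distrib (WithConv.toConv f) (WithConv.toConv g) c
  exact this

theorem cst_comp {D : Type*} [AddCommGroup D] [Module k D] [Coalgebra k D] (b : B)
    (c : D →ₗc[k] C) : (cst b : C →ₗ[k] B) ∘ₗ c.toLinearMap = cst b := by
  ext x; simp [cst]

theorem conv_mem {A : Submodule k B} (f g : C →ₗ[k] B) (h : ∀ x y, f x * g y ∈ A) (c : C) :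
    (f ⋆ g) c ∈ A := by
  rw [conv_repr _ _ (ℛ k c)]
  exact Submodule.sum_mem _ fun i _ => h _ _

end Convolution

section PartialRep

variable {k H B : Type*} [CommRing k] [Ring H] [HopfAlgebra k H] [Ring B] [Algebra k B]

local infixl:70 " ⋆ " => conv
local notation "S" => HopfAlgebra.antipode k (A := H)

/-- A partial representation `π : H → B`:
* `π(1) = 1`;
* `π(h) π(x₍₁₎) π(S(x₍₂₎)) = π(h x₍₁₎) π(S(x₍₂₎))`;
* `π(h₍₁₎) π(S(h₍₂₎)) π(x) = π(h₍₁₎) π(S(h₍₂₎) x)`. -/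
structure IsPartialRep (π : H →ₗ[k] B) : Prop where
  map_one : π 1 = 1
  mul_conv (h x : H) :
    π h * conv π (π ∘ₗ HopfAlgebra.antipode k) x =
      conv (π ∘ₗ LinearMap.mulLeft k h) (π ∘ₗ HopfAlgebra.antipode k) x
  conv_mul (h x : H) :
    conv π (π ∘ₗ HopfAlgebra.antipode k) h * π x =
      conv π (π ∘ₗ LinearMap.mulRight k x ∘ₗ HopfAlgebra.antipode k) h

theorem antipode_conv_id : S ⋆ LinearMap.id = cst 1 := by
  rw [conv_eq, LinearMap.antipode_mul_id]; ext; simp [cst, LinearMap.convOne_def, Algebra.algebraMap_eq_smul_one]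

theorem id_conv_antipode : LinearMap.id ⋆ S = cst 1 := by
  rw [conv_eq, LinearMap.id_mul_antipode]; ext; simp [cst, LinearMap.convOne_def, Algebra.algebraMap_eq_smul_one]

variable {C : Type*} [AddCommGroup C] [Module k C] [Coalgebra k C]

theorem coassoc_left (Θ : H ⊗[k] (H ⊗[k] H) →ₗ[k] B) (f : C →ₗc[k] H) (F : C →ₗ[k] H) :
    Θ ∘ₗ (TensorProduct.assoc k H H H).toLinearMap ∘ₗ (comul (R := k)).rTensor H ∘ₗ
        TensorProduct.map f.toLinearMap F ∘ₗ comul =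
      Θ ∘ₗ TensorProduct.map f.toLinearMap (TensorProduct.map f.toLinearMap F ∘ₗ comul) ∘ₗ
        comul := by
  congr 1
  have h1 : (comul (R := k) (A := H)).rTensor H ∘ₗ TensorProduct.map f.toLinearMap F =
      TensorProduct.map (TensorProduct.map f.toLinearMap f.toLinearMap) F ∘ₗ
        (comul (R := k) (A := C)).rTensor C := by
    rw [LinearMap.rTensor, LinearMap.rTensor, ← TensorProduct.map_comp, ← TensorProduct.map_comp,
      show comul ∘ₗ f.toLinearMap = map f.toLinearMap f.toLinearMap ∘ₗ comul from
        (CoalgHomClass.map_comp_comul f).symm]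
    simp only [LinearMap.id_comp, LinearMap.comp_id]
  rw [← LinearMap.comp_assoc comul (TensorProduct.map _ _) ((comul (R := k) (A := H)).rTensor H), h1]
  have h2 : (TensorProduct.assoc k H H H).toLinearMap ∘ₗ
      TensorProduct.map (TensorProduct.map f.toLinearMap f.toLinearMap) F =
      TensorProduct.map f.toLinearMap (TensorProduct.map f.toLinearMap F) ∘ₗ
       (TensorProduct.assoc k C C C).toLinearMap := by
    ext; simp
  rw [LinearMap.comp_assoc, ← LinearMap.comp_assoc, h2, LinearMap.comp_assoc, coassoc,
    ← LinearMap.comp_assoc]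
  congr 1
  ext; simp

theorem coassoc_right (Θ : (H ⊗[k] H) ⊗[k] H →ₗ[k] B) (f : C →ₗc[k] H) (F : C →ₗ[k] H) :
    Θ ∘ₗ (TensorProduct.assoc k H H H).symm.toLinearMap ∘ₗ (comul (R := k)).lTensor H ∘ₗ
        TensorProduct.map F f.toLinearMap ∘ₗ comul =
      Θ ∘ₗ TensorProduct.map (TensorProduct.map F f.toLinearMap ∘ₗ comul) f.toLinearMap ∘ₗ
        comul := by
  congr 1
  have h1 : (comul (R := k) (A := H)).lTensor H ∘ₗ TensorProduct.map F f.toLinearMap =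
      TensorProduct.map F (TensorProduct.map f.toLinearMap f.toLinearMap) ∘ₗ
        (comul (R := k) (A := C)).lTensor C := by
    rw [LinearMap.lTensor, LinearMap.lTensor, ← TensorProduct.map_comp, ← TensorProduct.map_comp,
      show comul ∘ₗ f.toLinearMap = map f.toLinearMap f.toLinearMap ∘ₗ comul from
        (CoalgHomClass.map_comp_comul f).symm]
    simp only [LinearMap.id_comp, LinearMap.comp_id]
  rw [← LinearMap.comp_assoc comul (TensorProduct.map _ _) ((comul (R := k) (A := H)).lTensor H), h1]
  have h2 : (TensorProduct.assoc k H H H).symm.toLinearMap ∘ₗ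
      TensorProduct.map F (TensorProduct.map f.toLinearMap f.toLinearMap) =
      TensorProduct.map (TensorProduct.map F f.toLinearMap) f.toLinearMap ∘ₗ
       (TensorProduct.assoc k C C C).symm.toLinearMap := by
    apply TensorProduct.ext; ext; simp
  rw [LinearMap.comp_assoc, ← LinearMap.comp_assoc, h2, LinearMap.comp_assoc, coassoc_symm,
    ← LinearMap.comp_assoc]
  congr 1
  ext; simp

namespace IsPartialRep

variable {π : H →ₗ[k] B}

theorem conv_mul' (hπ : IsPartialRep π) (f : C →ₗc[k] H) (F : C →ₗ[k] H) :
    (π ∘ₗ f.toLinearMap) ⋆ (π ∘ₗ S ∘ₗ f.toLinearMap) ⋆ (π ∘ₗ F) =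
      (π ∘ₗ f.toLinearMap) ⋆ (π ∘ₗ ((S ∘ₗ f.toLinearMap) ⋆ F)) := by
  have key : LinearMap.mul' k B ∘ₗ TensorProduct.map (π ⋆ (π ∘ₗ S)) π =
      (LinearMap.mul' k B ∘ₗ TensorProduct.map π (π ∘ₗ LinearMap.mul' k H ∘ₗ
        TensorProduct.map S LinearMap.id)) ∘ₗ (TensorProduct.assoc k H H H).toLinearMap ∘ₗ
        (comul (R := k)).rTensor H := by
    ext h x
    simp only [AlgebraTensorModule.curry_apply, LinearMap.restrictScalars_self, curry_apply,
      LinearMap.comp_apply, TensorProduct.map_tmul, LinearMap.mul'_apply, LinearMap.rTensor_tmul]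
    rw [hπ.conv_mul, conv_repr _ _ (ℛ k h), ← (ℛ k h).eq]
    simp [TensorProduct.sum_tmul]
  have h3 := congrArg (fun L => L ∘ₗ TensorProduct.map f.toLinearMap F ∘ₗ comul) key
  simp only [LinearMap.comp_assoc] at h3
  have h4 := coassoc_left (LinearMap.mul' k B ∘ₗ TensorProduct.map π (π ∘ₗ LinearMap.mul' k H ∘ₗ
        TensorProduct.map S LinearMap.id)) f F
  simp only [LinearMap.comp_assoc] at h4
  rw [h4] at h3
  refine Eq.trans ?_ (h3.trans ?_)
  · have := conv_comp π (π ∘ₗ S) f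
    rw [LinearMap.comp_assoc] at this
    rw [← this, conv, ← LinearMap.comp_assoc comul (TensorProduct.map _ _) (TensorProduct.map _ _), ← TensorProduct.map_comp]
  · rw [← LinearMap.comp_assoc _ (TensorProduct.map _ _) (TensorProduct.map _ _),
      ← TensorProduct.map_comp]
    simp only [conv, LinearMap.comp_assoc]
    rw [← LinearMap.comp_assoc _ (TensorProduct.map _ _) (TensorProduct.map _ _),
      ← TensorProduct.map_comp, LinearMap.id_comp]

theorem mul_conv' (hπ : IsPartialRep π) (f : C →ₗc[k] H) (F : C →ₗ[k] H) :
    (π ∘ₗ F) ⋆ ((π ∘ₗ f.toLinearMap) ⋆ (π ∘ₗ S ∘ₗ f.toLinearMap)) =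
      (π ∘ₗ (F ⋆ f.toLinearMap)) ⋆ (π ∘ₗ S ∘ₗ f.toLinearMap) := by
  have key : LinearMap.mul' k B ∘ₗ TensorProduct.map π (π ⋆ (π ∘ₗ S)) =
      (LinearMap.mul' k B ∘ₗ TensorProduct.map (π ∘ₗ LinearMap.mul' k H) (π ∘ₗ S)) ∘ₗ
        (TensorProduct.assoc k H H H).symm.toLinearMap ∘ₗ
        (comul (R := k)).lTensor H := by
    ext h x
    simp only [AlgebraTensorModule.curry_apply, LinearMap.restrictScalars_self, curry_apply,
      LinearMap.comp_apply, TensorProduct.map_tmul, LinearMap.mul'_apply, LinearMap.lTensor_tmul]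
    rw [hπ.mul_conv, conv_repr _ _ (ℛ k x), ← (ℛ k x).eq]
    simp [TensorProduct.tmul_sum]
  have h3 := congrArg (fun L => L ∘ₗ TensorProduct.map F f.toLinearMap ∘ₗ comul) key
  simp only [LinearMap.comp_assoc] at h3
  have h4 := coassoc_right (LinearMap.mul' k B ∘ₗ TensorProduct.map (π ∘ₗ LinearMap.mul' k H)
    (π ∘ₗ S)) f F
  simp only [LinearMap.comp_assoc] at h4
  rw [h4] at h3
  refine Eq.trans ?_ (h3.trans ?_)
  · have := conv_comp π (π ∘ₗ S) f
    rw [LinearMap.comp_assoc] at this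
    rw [← this, conv, ← LinearMap.comp_assoc comul (TensorProduct.map _ _) (TensorProduct.map _ _), ← TensorProduct.map_comp]
  · rw [← LinearMap.comp_assoc _ (TensorProduct.map _ _) (TensorProduct.map _ _),
      ← TensorProduct.map_comp]
    simp only [conv, LinearMap.comp_assoc]

end IsPartialRep

theorem comp_cst {B' : Type*} [Ring B'] [Algebra k B'] (g : B →ₗ[k] B') (b : B) :
    g ∘ₗ (cst b : C →ₗ[k] B) = cst (g b) := by
  ext; simp [cst]

theorem cst_add (a b : B) : (cst (a + b) : C →ₗ[k] B) = cst a + cst b := by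
  ext; simp [cst]

theorem conv_add (f g h : C →ₗ[k] B) : f ⋆ (g + h) = f ⋆ g + f ⋆ h := by
  simp [conv, TensorProduct.map_add_right, LinearMap.add_comp, LinearMap.comp_add]

theorem add_conv (f g h : C →ₗ[k] B) : (f + g) ⋆ h = f ⋆ h + g ⋆ h := by
  simp [conv, TensorProduct.map_add_left, LinearMap.add_comp, LinearMap.comp_add]

theorem cst_mul (a b : B) : (cst (a * b) : C →ₗ[k] B) = cst a ⋆ cst b := by
  rw [conv_cst]; ext; simp [cst]

theorem cst_algebraMap (r : k) (f : C →ₗ[k] B) : f ⋆ cst (algebraMap k B r) = r • f := by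
  rw [conv_cst]; ext; simp [Algebra.smul_def, Algebra.commutes]

variable (k H) in
/-- `x ⊗ y ↦ ε(y) x` -/
def pr₁ : H ⊗[k] H →ₗc[k] H :=
  (Coalgebra.TensorProduct.rid k k H).toCoalgHom.comp
    (Coalgebra.TensorProduct.map (CoalgHom.id k H) (counitCoalgHom k H))

variable (k H) in
/-- `x ⊗ y ↦ ε(x) y` -/
def pr₂ : H ⊗[k] H →ₗc[k] H :=
  (Coalgebra.TensorProduct.lid k H).toCoalgHom.comp
    (Coalgebra.TensorProduct.map (counitCoalgHom k H) (CoalgHom.id k H))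

@[simp] theorem pr₁_tmul (x y : H) : pr₁ k H (x ⊗ₜ y) = counit (R := k) y • x := rfl

@[simp] theorem pr₂_tmul (x y : H) : pr₂ k H (x ⊗ₜ y) = counit (R := k) x • y := rfl

local notation "p₁" => (CoalgHom.toLinearMap (pr₁ k H))
local notation "p₂" => (CoalgHom.toLinearMap (pr₂ k H))
local notation "μ" => (CoalgHom.toLinearMap (Bialgebra.mulCoalgHom k H))

theorem conv_one (f g : H →ₗ[k] B) : (f ⋆ g) 1 = f 1 * g 1 := by
  rw [conv, LinearMap.comp_apply, LinearMap.comp_apply, Bialgebra.comul_one,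
    Algebra.TensorProduct.one_def, TensorProduct.map_tmul, LinearMap.mul'_apply]

theorem cst_apply_one (b : B) : (cst b : H →ₗ[k] B) 1 = b := by
  simp [cst]

theorem sum_counit_right {ι : Type*} {y : H} (r : Repr k y ι) :
    ∑ i ∈ r.index, counit (R := k) (r.right i) • r.left i = y := by
  have h1 := congrArg (TensorProduct.rid k H) (lTensor_counit_comul (R := k) y)
  rw [← r.eq] at h1
  simpa only [map_sum, LinearMap.lTensor_tmul, TensorProduct.rid_tmul, one_smul] using h1

theorem sum_counit_left {ι : Type*} {y : H} (r : Repr k y ι) :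
    ∑ i ∈ r.index, counit (R := k) (r.left i) • r.right i = y := by
  have h1 := congrArg (TensorProduct.lid k H) (rTensor_counit_comul (R := k) y)
  rw [← r.eq] at h1
  simpa only [map_sum, LinearMap.rTensor_tmul, TensorProduct.lid_tmul, one_smul] using h1

theorem conv_tmul (K L : H ⊗[k] H →ₗ[k] B) (x y : H) {ι κ : Type*} (r : Repr k x ι)
    (s : Repr k y κ) :
    (K ⋆ L) (x ⊗ₜ y) = ∑ i ∈ r.index, ∑ j ∈ s.index,
      K (r.left i ⊗ₜ s.left j) * L (r.right i ⊗ₜ s.right j) := by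
  rw [conv, LinearMap.comp_apply, LinearMap.comp_apply, TensorProduct.comul_tmul, ← r.eq, ← s.eq]
  simp only [TensorProduct.sum_tmul, TensorProduct.tmul_sum, map_sum, TensorProduct.map_tmul,
    AlgebraTensorModule.tensorTensorTensorComm_tmul, LinearMap.mul'_apply]
  rw [Finset.sum_comm]

theorem conv_pr₁_tmul (K : H ⊗[k] H →ₗ[k] B) (f : H →ₗ[k] B) (x y : H) {ι : Type*}
    (r : Repr k x ι) :
    (K ⋆ (f ∘ₗ p₁)) (x ⊗ₜ y) = ∑ i ∈ r.index, K (r.left i ⊗ₜ y) * f (r.right i) := by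
  rw [conv_tmul _ _ _ _ r (ℛ k y)]
  refine Finset.sum_congr rfl fun i _ => ?_
  conv_rhs => rw [← sum_counit_right (ℛ k y)]
  simp [TensorProduct.tmul_sum, Finset.sum_mul]

theorem pr₁_conv_tmul (K : H ⊗[k] H →ₗ[k] B) (f : H →ₗ[k] B) (x y : H) {ι : Type*}
    (r : Repr k x ι) :
    ((f ∘ₗ p₁) ⋆ K) (x ⊗ₜ y) = ∑ i ∈ r.index, f (r.left i) * K (r.right i ⊗ₜ y) := by
  rw [conv_tmul _ _ _ _ r (ℛ k y)]
  refine Finset.sum_congr rfl fun i _ => ?_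
  conv_rhs => rw [← sum_counit_left (ℛ k y)]
  simp [TensorProduct.tmul_sum, Finset.mul_sum]

theorem conv_pr₂_tmul (K : H ⊗[k] H →ₗ[k] B) (f : H →ₗ[k] B) (x y : H) {ι : Type*}
    (s : Repr k y ι) :
    (K ⋆ (f ∘ₗ p₂)) (x ⊗ₜ y) = ∑ j ∈ s.index, K (x ⊗ₜ s.left j) * f (s.right j) := by
  rw [conv_tmul _ _ _ _ (ℛ k x) s, Finset.sum_comm]
  refine Finset.sum_congr rfl fun i _ => ?_
  conv_rhs => rw [← sum_counit_right (ℛ k x)]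
  simp [TensorProduct.sum_tmul, Finset.sum_mul, ← TensorProduct.smul_tmul']

theorem pr₁_conv_pr₂ : p₁ ⋆ p₂ = μ := by
  ext x y
  have := pr₁_conv_tmul p₂ LinearMap.id x y (ℛ k x)
  rw [LinearMap.id_comp] at this
  simp only [AlgebraTensorModule.curry_apply, LinearMap.restrictScalars_self, curry_apply]
  rw [this]
  have h2 := sum_counit_right (ℛ k x)
  conv_rhs => rw [← h2]
  simp [Finset.sum_mul]

theorem antipode_mul_eq : (S ∘ₗ p₂) ⋆ (S ∘ₗ p₁) = S ∘ₗ μ := by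
  ext x y
  have := conv_pr₁_tmul (S ∘ₗ p₂) S x y (ℛ k x)
  simp only [AlgebraTensorModule.curry_apply, LinearMap.restrictScalars_self, curry_apply]
  rw [this]
  have h2 := sum_counit_left (ℛ k x)
  have h3 : S (x * y) = S y * S x := HopfAlgebra.antipode_mul_antidistrib x y
  rw [show (S ∘ₗ μ) (x ⊗ₜ y) = S (x * y) from rfl, h3]
  conv_rhs => rw [← h2]
  simp [Finset.mul_sum]

/-- Fixing the second tensor factor. -/
def slice (K : H ⊗[k] H →ₗ[k] B) (y : H) : H →ₗ[k] B := K ∘ₗ (TensorProduct.mk k H H).flip y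

theorem slice_pr₁ (f : H →ₗ[k] B) (y : H) : slice (f ∘ₗ p₁) y = counit (R := k) y • f := by
  ext; simp [slice]

theorem slice_pr₂ (f : H →ₗ[k] B) (y : H) : slice (f ∘ₗ p₂) y = cst (f y) := by
  ext; simp [slice, cst]

theorem slice_mul (f : H →ₗ[k] B) (y : H) : slice (f ∘ₗ μ) y = f ∘ₗ LinearMap.mulRight k y := by
  ext; simp [slice]

theorem slice_conv_pr₁ (K : H ⊗[k] H →ₗ[k] B) (f : H →ₗ[k] B) (y : H) :
    slice (K ⋆ (f ∘ₗ p₁)) y = slice K y ⋆ f := by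
  ext x
  rw [conv_repr _ _ (ℛ k x)]
  exact conv_pr₁_tmul K f x y (ℛ k x)

theorem slice_pr₁_conv (K : H ⊗[k] H →ₗ[k] B) (f : H →ₗ[k] B) (y : H) :
    slice ((f ∘ₗ p₁) ⋆ K) y = f ⋆ slice K y := by
  ext x
  rw [conv_repr _ _ (ℛ k x)]
  exact pr₁_conv_tmul K f x y (ℛ k x)

theorem antipode_conv (f : C →ₗc[k] H) : (S ∘ₗ f.toLinearMap) ⋆ f.toLinearMap = cst 1 := by
  have := conv_comp S LinearMap.id f
  rw [antipode_conv_id, LinearMap.id_comp, cst_comp] at this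
  exact this.symm

theorem conv_antipode (f : C →ₗc[k] H) : f.toLinearMap ⋆ (S ∘ₗ f.toLinearMap) = cst 1 := by
  have := conv_comp LinearMap.id S f
  rw [id_conv_antipode, LinearMap.id_comp, cst_comp] at this
  exact this.symm

/-- The elements `ε_h = π(h₍₁₎) π(S(h₍₂₎))`. -/
def eps (π : H →ₗ[k] B) : H →ₗ[k] B := conv π (π ∘ₗ HopfAlgebra.antipode k)

theorem eps_comp (π : H →ₗ[k] B) (f : C →ₗc[k] H) : eps π ∘ₗ f.toLinearMap =
    (π ∘ₗ f.toLinearMap) ⋆ (π ∘ₗ S ∘ₗ f.toLinearMap) := by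
  rw [eps, conv_comp, LinearMap.comp_assoc]

/-- The subalgebra generated by the elements `ε_h`. -/
def epsAlg (π : H →ₗ[k] B) : Subalgebra k B := Algebra.adjoin k (Set.range (eps π))

/-- The linear maps `a ↦ π(h₍₁₎) a π(S(h₍₂₎))`. -/
def adj (π : H →ₗ[k] B) : H →ₗ[k] Module.End k B :=
  conv (LinearMap.mul k B ∘ₗ π) ((LinearMap.mul k B).flip ∘ₗ π ∘ₗ HopfAlgebra.antipode k)

theorem adj_apply (π : H →ₗ[k] B) (h : H) (a : B) :
    adj π h a = (π ⋆ cst a ⋆ (π ∘ₗ S)) h := by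
  rw [adj, conv_repr _ _ (ℛ k h), conv_cst, conv_repr _ _ (ℛ k h)]
  simp [mul_assoc]

theorem eps_eq_adj (π : H →ₗ[k] B) (h : H) : eps π h = adj π h 1 := by
  rw [adj_apply, conv_cst_one, eps]

namespace IsPartialRep

variable {π : H →ₗ[k] B}

theorem conv_self (hπ : IsPartialRep π) (f : C →ₗc[k] H) :
    (π ∘ₗ f.toLinearMap) ⋆ (π ∘ₗ S ∘ₗ f.toLinearMap) ⋆ (π ∘ₗ f.toLinearMap) =
      π ∘ₗ f.toLinearMap := by
  rw [hπ.conv_mul', antipode_conv, comp_cst, hπ.map_one, conv_cst_one]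

theorem antipode_conv_self (hπ : IsPartialRep π) (f : C →ₗc[k] H) :
    (π ∘ₗ S ∘ₗ f.toLinearMap) ⋆ (π ∘ₗ f.toLinearMap) ⋆ (π ∘ₗ S ∘ₗ f.toLinearMap) =
      π ∘ₗ S ∘ₗ f.toLinearMap := by
  rw [conv_assoc, hπ.mul_conv', antipode_conv, comp_cst, hπ.map_one, cst_one_conv]

/-- `π(S(h₍₁₎)) π(h₍₂₎) π(x) = π(S(h₍₁₎)) π(h₍₂₎ x)` -/
theorem antipode_conv_mul' (hπ : IsPartialRep π) (f : C →ₗc[k] H) (F : C →ₗ[k] H) :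
    (π ∘ₗ S ∘ₗ f.toLinearMap) ⋆ (π ∘ₗ f.toLinearMap) ⋆ (π ∘ₗ F) =
      (π ∘ₗ S ∘ₗ f.toLinearMap) ⋆ (π ∘ₗ (f.toLinearMap ⋆ F)) := by
  have h1 := hπ.conv_mul' f (f.toLinearMap ⋆ F)
  rw [← conv_assoc (S ∘ₗ _), antipode_conv, cst_one_conv] at h1
  rw [conv_assoc, ← h1, ← conv_assoc, ← conv_assoc, hπ.antipode_conv_self]

theorem eps_mul_conv_pr₁ (hπ : IsPartialRep π) :
    (eps π ∘ₗ μ) ⋆ (π ∘ₗ p₁) = (π ∘ₗ p₁) ⋆ (eps π ∘ₗ p₂) := by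
  rw [eps_comp, hπ.conv_mul', eps_comp, hπ.mul_conv', pr₁_conv_pr₂, ← antipode_mul_eq, conv_assoc,
    antipode_conv, conv_cst_one]

/-- `ε_{h₍₁₎x} π(h₍₂₎) = π(h) ε_x` -/
theorem eps_conv (hπ : IsPartialRep π) (x : H) :
    (eps π ∘ₗ LinearMap.mulRight k x) ⋆ π = π ⋆ cst (eps π x) := by
  have := congrArg (fun K => slice K x) hπ.eps_mul_conv_pr₁
  simpa only [slice_conv_pr₁, slice_pr₁_conv, slice_mul, slice_pr₂] using this

/-- `π(S(h₍₁₎)) ε_{h₍₂₎x} = ε_x π(S(h))` -/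
theorem antipode_conv_eps (hπ : IsPartialRep π) (x : H) :
    (π ∘ₗ S) ⋆ (eps π ∘ₗ LinearMap.mulRight k x) = cst (eps π x) ⋆ (π ∘ₗ S) := by
  have h1 : ((π ∘ₗ S) ∘ₗ p₁) ⋆ (eps π ∘ₗ μ) = (eps π ∘ₗ p₂) ⋆ ((π ∘ₗ S) ∘ₗ p₁) := by
    rw [eps_comp, LinearMap.comp_assoc, hπ.mul_conv', ← pr₁_conv_pr₂, ← conv_assoc,
      antipode_conv, cst_one_conv, pr₁_conv_pr₂, eps_comp, hπ.conv_mul', antipode_mul_eq]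
  have := congrArg (fun K => slice K x) h1
  simpa only [slice_conv_pr₁, slice_pr₁_conv, slice_mul, slice_pr₂] using this

/-- `π(S(h₍₁₎)) π(h₍₂₎)` commutes with every element of the subalgebra generated by the `ε_x`. -/
theorem cst_comm (hπ : IsPartialRep π) {a : B} (ha : a ∈ epsAlg π) :
    cst a ⋆ ((π ∘ₗ S) ⋆ π) = ((π ∘ₗ S) ⋆ π) ⋆ cst a := by
  induction ha using Algebra.adjoin_induction with
  | mem b hb =>
    obtain ⟨x, rfl⟩ := hb
    rw [conv_assoc (π ∘ₗ S), ← hπ.eps_conv, ← conv_assoc (π ∘ₗ S), hπ.antipode_conv_eps,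
      conv_assoc]
  | algebraMap r =>
    ext h
    simp [cst_conv, conv_cst, Algebra.commutes]
  | add a b _ _ ha hb => rw [cst_add, conv_add, add_conv, ha, hb]
  | mul a b _ _ ha hb => rw [cst_mul, conv_assoc, hb, ← conv_assoc, ha, conv_assoc]

theorem conv_congr (hπ : IsPartialRep π) {a : B} (ha : a ∈ epsAlg π) (f : C →ₗc[k] H) (U V : C →ₗ[k] B)
    (h : (π ∘ₗ f.toLinearMap) ⋆ U = (π ∘ₗ f.toLinearMap) ⋆ V) :
    (π ∘ₗ f.toLinearMap) ⋆ (cst a ⋆ U) = (π ∘ₗ f.toLinearMap) ⋆ (cst a ⋆ V) := by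
  induction ha using Algebra.adjoin_induction generalizing U V with
  | mem b hb =>
    obtain ⟨x, rfl⟩ := hb
    have := congrArg (fun L => L ∘ₗ f.toLinearMap) (hπ.eps_conv x)
    simp only [conv_comp, cst_comp] at this
    rw [← conv_assoc, ← this, ← conv_assoc, ← this, conv_assoc, h, conv_assoc]
  | algebraMap r =>
    rw [← conv_assoc, ← conv_assoc, cst_algebraMap]
    simp only [conv, TensorProduct.map_smul_left, LinearMap.smul_comp, LinearMap.comp_smul] at h ⊢
    rw [h]
  | add a b _ _ ha hb => rw [cst_add, add_conv, conv_add, ha U V h, hb U V h, add_conv, conv_add]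
  | mul a b _ _ ha hb => rw [cst_mul, conv_assoc, conv_assoc, ha _ _ (hb _ _ h)]

/-- `π(h₍₁₎) a π(S(h₍₂₎) x) = π(h₍₁₎) a π(S(h₍₂₎)) π(x)` -/
theorem conv_cst_conv (hπ : IsPartialRep π) {a : B} (ha : a ∈ epsAlg π) (f : C →ₗc[k] H) (F : C →ₗ[k] H) :
    (π ∘ₗ f.toLinearMap) ⋆ (cst a ⋆ (π ∘ₗ ((S ∘ₗ f.toLinearMap) ⋆ F))) =
      (π ∘ₗ f.toLinearMap) ⋆ (cst a ⋆ ((π ∘ₗ S ∘ₗ f.toLinearMap) ⋆ (π ∘ₗ F))) := by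
  apply hπ.conv_congr ha
  rw [← conv_assoc, hπ.conv_mul']

theorem conv_mem_epsAlg (hπ : IsPartialRep π) {a : B} (ha : a ∈ epsAlg π) (U : H →ₗ[k] B)
    (h : ∀ x, (π ⋆ U) x ∈ epsAlg π) (x : H) : (π ⋆ (cst a ⋆ U)) x ∈ epsAlg π := by
  induction ha using Algebra.adjoin_induction generalizing U x with
  | mem b hb =>
    obtain ⟨y, rfl⟩ := hb
    rw [← conv_assoc, ← hπ.eps_conv y, conv_assoc, conv_repr _ _ (ℛ k x)]
    exact sum_mem fun i _ => mul_mem (Algebra.subset_adjoin ⟨_, rfl⟩) (h _)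
  | algebraMap r =>
    rw [← conv_assoc, cst_algebraMap]
    simp only [conv, TensorProduct.map_smul_left, LinearMap.smul_comp, LinearMap.comp_smul]
    exact Subalgebra.smul_mem _ (h x) r
  | add a b _ _ ha hb =>
    rw [cst_add, add_conv, conv_add]
    exact add_mem (ha U h x) (hb U h x)
  | mul a b _ _ ha hb =>
    rw [cst_mul, conv_assoc]
    exact ha _ (fun y => hb _ h y) x

theorem adj_mem (hπ : IsPartialRep π) {a : B} (ha : a ∈ epsAlg π) (h : H) : adj π h a ∈ epsAlg π := by
  rw [adj_apply, conv_assoc]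
  exact hπ.conv_mem_epsAlg ha _ (fun x => Algebra.subset_adjoin ⟨x, rfl⟩) h

/-- `h • (x • a) = ε_{h₍₁₎} (h₍₂₎x • a)` -/
theorem adj_adj (hπ : IsPartialRep π) {a : B} (ha : a ∈ epsAlg π) (h x : H) :
    adj π h (adj π x a) =
      (eps π ⋆ ((adj π).flip a ∘ₗ LinearMap.mulRight k x)) h := by
  have hP : (adj π).flip a = π ⋆ cst a ⋆ (π ∘ₗ S) := by ext h; exact adj_apply π h a
  have h1 : ((π ∘ₗ p₁) ⋆ ((adj π).flip a ∘ₗ p₂)) ⋆ ((π ∘ₗ S) ∘ₗ p₁) =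
      (eps π ∘ₗ p₁) ⋆ ((adj π).flip a ∘ₗ μ) := by
    rw [hP, conv_comp, conv_comp, conv_comp, conv_comp, eps_comp]
    simp only [LinearMap.comp_assoc, cst_comp]
    conv_rhs => rw [conv_assoc, ← conv_assoc, ← conv_assoc, ← conv_assoc, ← pr₁_conv_pr₂,
      hπ.conv_mul', ← conv_assoc, antipode_conv, cst_one_conv, pr₁_conv_pr₂, ← antipode_mul_eq]
    simp only [conv_assoc]
    rw [hπ.conv_cst_conv ha]
  have := congrArg (fun K => slice K x h) h1
  simp only [slice_conv_pr₁, slice_pr₁_conv, slice_mul, slice_pr₂] at this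
  rw [adj_apply]
  exact this

/-- `π(h₍₁₎) a π(S(h₍₂₎)) π(h₍₃₎ x) = π(h) a π(x)` -/
theorem adj_conv_mulRight (hπ : IsPartialRep π) {a : B} (ha : a ∈ epsAlg π) (h x : H) :
    ((adj π).flip a ⋆ (π ∘ₗ LinearMap.mulRight k x)) h = π h * a * π x := by
  have hP : (adj π).flip a = π ⋆ cst a ⋆ (π ∘ₗ S) := by ext h; exact adj_apply π h a
  have h1 := hπ.conv_cst_conv ha (CoalgHom.id k H) (LinearMap.mulRight k x)
  have h2 : S ⋆ LinearMap.mulRight k x = cst x := by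
    have : LinearMap.mulRight k x = LinearMap.id ⋆ cst x := by rw [conv_cst]; rfl
    rw [this, ← conv_assoc, antipode_conv_id, cst_one_conv]
  rw [show (CoalgHom.id k H).toLinearMap = LinearMap.id from rfl, LinearMap.comp_id,
    LinearMap.comp_id, h2, comp_cst] at h1
  rw [hP, conv_assoc, conv_assoc, ← h1, ← conv_assoc, conv_cst, conv_cst]
  rfl

theorem adj_conv (hπ : IsPartialRep π) {a : B} (ha : a ∈ epsAlg π) (f : C →ₗc[k] H) (F : C →ₗ[k] H) (c : C) :
    ((adj π ∘ₗ f.toLinearMap) ⋆ (adj π ∘ₗ F)) c a =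
      ((eps π ∘ₗ f.toLinearMap) ⋆ ((adj π).flip a ∘ₗ (f.toLinearMap ⋆ F))) c := by
  have key : TensorProduct.lift ((adj π).compl₂ ((adj π).flip a)) =
      (LinearMap.mul' k B ∘ₗ TensorProduct.map (eps π) ((adj π).flip a ∘ₗ LinearMap.mul' k H)) ∘ₗ
        (TensorProduct.assoc k H H H).toLinearMap ∘ₗ (comul (R := k)).rTensor H := by
    ext h x
    simp only [AlgebraTensorModule.curry_apply, LinearMap.restrictScalars_self, curry_apply,
      lift.tmul, LinearMap.compl₂_apply, LinearMap.flip_apply]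
    rw [hπ.adj_adj ha, conv_repr _ _ (ℛ k h)]
    simp [TensorProduct.sum_tmul, ← (ℛ k h).eq]
  have h3 := congrArg (fun L => (L ∘ₗ TensorProduct.map f.toLinearMap F ∘ₗ comul) c) key
  have h4 := coassoc_left (LinearMap.mul' k B ∘ₗ TensorProduct.map (eps π)
    ((adj π).flip a ∘ₗ LinearMap.mul' k H)) f F
  simp only [LinearMap.comp_assoc] at h3 h4
  rw [h4] at h3
  refine Eq.trans ?_ (h3.trans ?_)
  · rw [conv_repr _ _ (ℛ k c)]
    simp [← (ℛ k c).eq]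
  · rw [← LinearMap.comp_assoc _ (TensorProduct.map _ _) (TensorProduct.map _ _),
      ← TensorProduct.map_comp]
    rfl

/-- The action `h • a = π(h₍₁₎) a π(S(h₍₂₎))` on the subalgebra generated by the `ε_x`. -/
def epsAct (hπ : IsPartialRep π) : H →ₗ[k] Module.End k (epsAlg π) where
  toFun h := (adj π h).restrict (p := (epsAlg π).toSubmodule) (q := (epsAlg π).toSubmodule)
    fun _ ha => hπ.adj_mem ha h
  map_add' x y := by ext; simp
  map_smul' r x := by ext; simp

theorem coe_epsAct (hπ : IsPartialRep π) (h : H) (a : epsAlg π) : (hπ.epsAct h a : B) = adj π h a := rfl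

theorem coe_epsAct_conv (hπ : IsPartialRep π) (F G : H →ₗ[k] H) (h : H) (a : epsAlg π) :
    ((((hπ.epsAct ∘ₗ F) ⋆ (hπ.epsAct ∘ₗ G)) h a : epsAlg π) : B) =
      ((adj π ∘ₗ F) ⋆ (adj π ∘ₗ G)) h a := by
  rw [conv_repr _ _ (ℛ k h), conv_repr _ _ (ℛ k h)]
  simp [coe_epsAct]

theorem adj_one (hπ : IsPartialRep π) (a : B) : adj π 1 a = a := by
  simp [adj_apply, conv_one, cst_apply_one, hπ.map_one]

theorem adj_conv_antipode (hπ : IsPartialRep π) {a : B} (ha : a ∈ epsAlg π) (h : H) :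
    (adj π ⋆ (adj π ∘ₗ S)) h a = eps π h * a := by
  have h1 := hπ.adj_conv ha (CoalgHom.id k H) S h
  rw [show (CoalgHom.id k H).toLinearMap = LinearMap.id from rfl, LinearMap.comp_id,
    LinearMap.comp_id, id_conv_antipode, comp_cst, conv_cst] at h1
  rw [h1, LinearMap.comp_apply, LinearMap.mulRight_apply, LinearMap.flip_apply, hπ.adj_one]

theorem isPartialRep_epsAct (hπ : IsPartialRep π) : IsPartialRep hπ.epsAct where
  map_one := by
    ext a
    rw [coe_epsAct, hπ.adj_one]
    rfl
  mul_conv h x := by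
    ext a
    have h1 := hπ.coe_epsAct_conv LinearMap.id S x a
    have h2 := hπ.coe_epsAct_conv (LinearMap.mulLeft k h) S x a
    rw [LinearMap.comp_id, LinearMap.comp_id] at h1
    rw [h2, Module.End.mul_apply, coe_epsAct, h1, hπ.adj_conv_antipode a.2]
    have h3 := conv_pr₂_tmul (adj π ∘ₗ μ) (adj π ∘ₗ S) h x (ℛ k x)
    have h4 : ((adj π ∘ₗ LinearMap.mulLeft k h) ⋆ (adj π ∘ₗ S)) x =
        ((adj π ∘ₗ μ) ⋆ ((adj π ∘ₗ S) ∘ₗ p₂)) (h ⊗ₜ x) := by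
      rw [h3, conv_repr _ _ (ℛ k x)]
      rfl
    rw [h4, LinearMap.comp_assoc, hπ.adj_conv a.2, ← pr₁_conv_pr₂, conv_assoc, conv_antipode,
      conv_cst_one, pr₁_conv_pr₂]
    have h5 := congrArg (fun L => L h)
      (slice_conv_pr₁ (eps π ∘ₗ μ) ((adj π).flip (a : B)) x)
    have hP : ∀ b, (adj π).flip b = π ⋆ cst b ⋆ (π ∘ₗ S) := by
      intro b; ext h; exact adj_apply π h b
    have h6 : (eps π ∘ₗ LinearMap.mulRight k x) ⋆ (adj π).flip (a : B) =
        (adj π).flip (eps π x * a) := by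
      rw [hP, hP, ← conv_assoc, ← conv_assoc, hπ.eps_conv, conv_assoc π, ← cst_mul]
    rw [slice_mul, h6] at h5
    exact h5.symm
  conv_mul h x := by
    ext a
    have h1 := hπ.coe_epsAct_conv LinearMap.id S h (hπ.epsAct x a)
    have h2 := hπ.coe_epsAct_conv LinearMap.id (LinearMap.mulRight k x ∘ₗ S) h a
    rw [LinearMap.comp_id, LinearMap.comp_id] at h1 h2
    rw [h2, Module.End.mul_apply, h1, hπ.adj_conv_antipode (hπ.epsAct x a).2, coe_epsAct]
    have h3 := hπ.adj_conv a.2 (CoalgHom.id k H) (LinearMap.mulRight k x ∘ₗ S) h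
    have h4 : LinearMap.id ⋆ (LinearMap.mulRight k x ∘ₗ S) = cst x := by
      rw [← conv_cst, ← conv_assoc, id_conv_antipode, cst_one_conv]
    rw [show (CoalgHom.id k H).toLinearMap = LinearMap.id from rfl, LinearMap.comp_id,
      LinearMap.comp_id, h4, comp_cst, conv_cst] at h3
    rw [h3]
    rfl

end IsPartialRep

theorem IsPartialRep.comp_algHom {π : H →ₗ[k] B} (hπ : IsPartialRep π) {B' : Type*} [Ring B']
    [Algebra k B'] (f : B →ₐ[k] B') : IsPartialRep (f.toLinearMap ∘ₗ π) := by
  constructor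
  · simp [hπ.map_one]
  · intro h x
    simp only [LinearMap.comp_assoc]
    rw [← algHom_comp_conv, ← algHom_comp_conv, LinearMap.comp_apply, LinearMap.comp_apply,
      LinearMap.comp_apply, ← hπ.mul_conv]
    simp
  · intro h x
    simp only [LinearMap.comp_assoc]
    rw [← algHom_comp_conv, ← algHom_comp_conv, LinearMap.comp_apply, LinearMap.comp_apply,
      LinearMap.comp_apply, ← hπ.conv_mul]
    simp

theorem comul_comp_antipode : comul ∘ₗ S =
    ((Algebra.TensorProduct.includeRight : H →ₐ[k] H ⊗[k] H).toLinearMap ∘ₗ S) ⋆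
      ((Algebra.TensorProduct.includeLeft : H →ₐ[k] H ⊗[k] H).toLinearMap ∘ₗ S) := by
  set i₁ := (Algebra.TensorProduct.includeLeft : H →ₐ[k] H ⊗[k] H)
  set i₂ := (Algebra.TensorProduct.includeRight : H →ₐ[k] H ⊗[k] H)
  have hi (i : H →ₐ[k] H ⊗[k] H) : i.toLinearMap ⋆ (i.toLinearMap ∘ₗ S) = cst 1 := by
    have := algHom_comp_conv i LinearMap.id S
    rw [id_conv_antipode, comp_cst, LinearMap.comp_id] at this
    rw [← this]; simp
  have hi' (i : H →ₐ[k] H ⊗[k] H) : (i.toLinearMap ∘ₗ S) ⋆ i.toLinearMap = cst 1 := by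
    have := algHom_comp_conv i S LinearMap.id
    rw [antipode_conv_id, comp_cst, LinearMap.comp_id] at this
    rw [← this]; simp
  have h0 : (Bialgebra.comulAlgHom k H).toLinearMap = i₁.toLinearMap ⋆ i₂.toLinearMap := by
    ext h
    rw [conv_repr _ _ (ℛ k h)]
    simp [i₁, i₂, (ℛ k h).eq]
  have h1 := hi (Bialgebra.comulAlgHom k H)
  have h2 := hi' (Bialgebra.comulAlgHom k H)
  have h3 : (Bialgebra.comulAlgHom k H).toLinearMap ⋆
      ((i₂.toLinearMap ∘ₗ S) ⋆ (i₁.toLinearMap ∘ₗ S)) = cst 1 := by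
    rw [h0, conv_assoc, ← conv_assoc i₂.toLinearMap, hi, cst_one_conv, hi]
  change (Bialgebra.comulAlgHom k H).toLinearMap ∘ₗ S = _
  rw [← conv_cst_one ((Bialgebra.comulAlgHom k H).toLinearMap ∘ₗ S), ← h3, ← conv_assoc, h2,
    cst_one_conv]

theorem conv_comp_antipode (α β : H →ₗ[k] B) (hc : ∀ x y, Commute (α x) (β y)) :
    (α ⋆ β) ∘ₗ S = (β ∘ₗ S) ⋆ (α ∘ₗ S) := by
  ext h
  have := congrArg (fun L => LinearMap.mul' k B (TensorProduct.map α β (L h)))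
    (comul_comp_antipode (k := k) (H := H))
  refine Eq.trans this ?_
  rw [conv_repr _ _ (ℛ k h), conv_repr _ _ (ℛ k h)]
  simp [(hc _ _).eq]

theorem sum_conv {ι : Type*} (s : Finset ι) (f : ι → C →ₗ[k] B) (g : C →ₗ[k] B) :
    (∑ i ∈ s, f i) ⋆ g = ∑ i ∈ s, f i ⋆ g := by
  ext c
  simp [conv_repr _ _ (ℛ k c), Finset.sum_mul, Finset.sum_comm (s := s)]

theorem conv_sum {ι : Type*} (s : Finset ι) (f : ι → C →ₗ[k] B) (g : C →ₗ[k] B) :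
    g ⋆ (∑ i ∈ s, f i) = ∑ i ∈ s, g ⋆ f i := by
  ext c
  simp [conv_repr _ _ (ℛ k c), Finset.mul_sum, Finset.sum_comm (s := s)]

theorem IsPartialRep.conv_algHom {α : H →ₗ[k] B} (hα : IsPartialRep α) (β : H →ₐ[k] B)
    (hc : ∀ x y, Commute (α x) (β y)) : IsPartialRep (α ⋆ β.toLinearMap) := by
  have hβ : β.toLinearMap ⋆ (β.toLinearMap ∘ₗ S) = cst 1 := by
    have := algHom_comp_conv β LinearMap.id S
    rw [id_conv_antipode, comp_cst, LinearMap.comp_id] at this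
    rw [← this]; simp
  have h0 : (α ⋆ β.toLinearMap) ⋆ ((α ⋆ β.toLinearMap) ∘ₗ S) = α ⋆ (α ∘ₗ S) := by
    rw [conv_comp_antipode _ _ hc, conv_assoc, ← conv_assoc β.toLinearMap, hβ, cst_one_conv]
  have hmul (h x : H) : (α ⋆ β.toLinearMap) (h * x) = ∑ i ∈ (ℛ k h).index, ∑ j ∈ (ℛ k x).index,
      α ((ℛ k h).left i * (ℛ k x).left j) * (β ((ℛ k h).right i) * β ((ℛ k x).right j)) := by
    rw [conv, LinearMap.comp_apply, LinearMap.comp_apply, Bialgebra.comul_mul]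
    conv_lhs => rw [← (ℛ k h).eq, ← (ℛ k x).eq]
    simp [Finset.sum_mul_sum]
  have hc' (x y : H) : β y * α x = α x * β y := (hc x y).eq.symm
  constructor
  · simp [conv_one, hα.map_one]
  · intro h x
    rw [h0]
    have h1 : (α ⋆ β.toLinearMap) ∘ₗ LinearMap.mulLeft k h = ∑ i ∈ (ℛ k h).index,
        cst (β ((ℛ k h).right i)) ⋆ ((α ∘ₗ LinearMap.mulLeft k ((ℛ k h).left i)) ⋆
          β.toLinearMap) := by
      ext y
      rw [LinearMap.comp_apply, LinearMap.mulLeft_apply, hmul]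
      simp only [cst_conv, LinearMap.sum_apply, LinearMap.comp_apply, LinearMap.mulLeft_apply]
      refine Finset.sum_congr rfl fun i _ => ?_
      rw [conv_repr _ _ (ℛ k y), Finset.mul_sum]
      refine Finset.sum_congr rfl fun j _ => ?_
      simp only [LinearMap.comp_apply, LinearMap.mulLeft_apply, AlgHom.toLinearMap_apply]
      rw [← mul_assoc, ← mul_assoc, hc']
    have hβ' (γ : H →ₗ[k] B) : γ ⋆ β.toLinearMap ⋆ ((α ⋆ β.toLinearMap) ∘ₗ S) = γ ⋆ (α ∘ₗ S) := by
      rw [conv_comp_antipode _ _ hc, conv_assoc, ← conv_assoc β.toLinearMap, hβ, cst_one_conv]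
    rw [h1, sum_conv, LinearMap.sum_apply, conv_repr α _ (ℛ k h), Finset.sum_mul]
    refine Finset.sum_congr rfl fun i _ => ?_
    rw [conv_assoc, hβ', cst_conv, LinearMap.comp_apply, LinearMap.mulLeft_apply, ← hα.mul_conv,
      ← mul_assoc, AlgHom.toLinearMap_apply, hc']
  · intro h x
    rw [h0]
    have h1 : ((α ⋆ β.toLinearMap) ∘ₗ LinearMap.mulRight k x) ∘ₗ S = ∑ j ∈ (ℛ k x).index,
        ((β.toLinearMap ∘ₗ S) ⋆ ((α ∘ₗ LinearMap.mulRight k ((ℛ k x).left j)) ∘ₗ S)) ⋆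
          cst (β ((ℛ k x).right j)) := by
      have : (α ⋆ β.toLinearMap) ∘ₗ LinearMap.mulRight k x = ∑ j ∈ (ℛ k x).index,
          ((α ∘ₗ LinearMap.mulRight k ((ℛ k x).left j)) ⋆ β.toLinearMap) ⋆
            cst (β ((ℛ k x).right j)) := by
        ext y
        rw [LinearMap.comp_apply, LinearMap.mulRight_apply, hmul, Finset.sum_comm]
        simp only [conv_cst, LinearMap.sum_apply, LinearMap.comp_apply, LinearMap.mulRight_apply]
        refine Finset.sum_congr rfl fun i _ => ?_
        rw [conv_repr _ _ (ℛ k y), Finset.sum_mul]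
        refine Finset.sum_congr rfl fun j _ => ?_
        simp only [LinearMap.comp_apply, LinearMap.mulRight_apply, AlgHom.toLinearMap_apply]
        rw [← mul_assoc]
      rw [this]
      ext y
      simp only [LinearMap.comp_apply, LinearMap.sum_apply, conv_cst]
      refine Finset.sum_congr rfl fun j _ => ?_
      rw [← conv_comp_antipode (α ∘ₗ LinearMap.mulRight k ((ℛ k x).left j)) β.toLinearMap
        (fun _ _ => hc _ _)]
      rfl
    rw [← LinearMap.comp_assoc, h1, conv_sum, LinearMap.sum_apply, conv_repr α _ (ℛ k x),
      Finset.mul_sum]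
    refine Finset.sum_congr rfl fun i _ => ?_
    rw [← conv_assoc, ← conv_assoc, conv_assoc α, hβ, conv_cst_one, conv_cst, LinearMap.comp_apply,
      LinearMap.mulRight_apply, LinearMap.comp_assoc, ← hα.conv_mul, mul_assoc,
      AlgHom.toLinearMap_apply]

end PartialRep

section PartialModules

variable (k : Type u) (H : Type v) [CommRing k] [Ring H] [HopfAlgebra k H]

/-- The relations defining the universal algebra of partial representations. -/
inductive ParRel : TensorAlgebra k H → TensorAlgebra k H → Prop
  | one : ParRel (TensorAlgebra.ι k 1) 1
  | mul_conv (h x : H) : ParRel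
      (TensorAlgebra.ι k h * conv (TensorAlgebra.ι k)
        (TensorAlgebra.ι k ∘ₗ HopfAlgebra.antipode k) x)
      (conv (TensorAlgebra.ι k ∘ₗ LinearMap.mulLeft k h)
        (TensorAlgebra.ι k ∘ₗ HopfAlgebra.antipode k) x)
  | conv_mul (h x : H) : ParRel
      (conv (TensorAlgebra.ι k) (TensorAlgebra.ι k ∘ₗ HopfAlgebra.antipode k) h *
        TensorAlgebra.ι k x)
      (conv (TensorAlgebra.ι k)
        (TensorAlgebra.ι k ∘ₗ LinearMap.mulRight k x ∘ₗ HopfAlgebra.antipode k) h)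

/-- The algebra `H_par`: the tensor algebra of the `k`-module `H` modulo the relations of a
partial representation. -/
def HPar : Type max u v := RingQuot (ParRel k H)

instance : Ring (HPar k H) := inferInstanceAs (Ring (RingQuot (ParRel k H)))

instance : Algebra k (HPar k H) := inferInstanceAs (Algebra k (RingQuot (ParRel k H)))

/-- The canonical projection of the tensor algebra onto `H_par`. -/
def HPar.mk : TensorAlgebra k H →ₐ[k] HPar k H := RingQuot.mkAlgHom k (ParRel k H)

/-- The universal partial representation `h ↦ [h]`. -/
def HPar.bracket : H →ₗ[k] HPar k H := (HPar.mk k H).toLinearMap ∘ₗ TensorAlgebra.ι k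

theorem HPar.isPartialRep_bracket : IsPartialRep (HPar.bracket k H) where
  map_one := by
    have := RingQuot.mkAlgHom_rel k (ParRel.one (k := k) (H := H))
    exact this.trans (map_one _)
  mul_conv h x := by
    have := RingQuot.mkAlgHom_rel k (ParRel.mul_conv (k := k) h x)
    have h2 : HPar.mk k H _ = HPar.mk k H _ := this
    rw [map_mul, ← AlgHom.toLinearMap_apply, ← AlgHom.toLinearMap_apply,
      ← AlgHom.toLinearMap_apply, ← LinearMap.comp_apply, ← LinearMap.comp_apply,
      ← LinearMap.comp_apply, algHom_comp_conv, algHom_comp_conv] at h2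
    exact h2
  conv_mul h x := by
    have := RingQuot.mkAlgHom_rel k (ParRel.conv_mul (k := k) h x)
    have h2 : HPar.mk k H _ = HPar.mk k H _ := this
    rw [map_mul, ← AlgHom.toLinearMap_apply, ← AlgHom.toLinearMap_apply,
      ← AlgHom.toLinearMap_apply, ← LinearMap.comp_apply, ← LinearMap.comp_apply,
      ← LinearMap.comp_apply, algHom_comp_conv, algHom_comp_conv] at h2
    exact h2

variable {k H} in
/-- The algebra map `H_par → B` induced by a partial representation `H → B`. -/
def HPar.lift {B : Type*} [Ring B] [Algebra k B] {π : H →ₗ[k] B} (hπ : IsPartialRep π) :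
    HPar k H →ₐ[k] B :=
  RingQuot.liftAlgHom k ⟨TensorAlgebra.lift k π, by
    have h0 : (TensorAlgebra.lift k π).toLinearMap ∘ₗ TensorAlgebra.ι k = π := by ext; simp
    have h1 (F : H →ₗ[k] H) : (TensorAlgebra.lift k π).toLinearMap ∘ₗ TensorAlgebra.ι k ∘ₗ F =
        π ∘ₗ F := by rw [← LinearMap.comp_assoc, h0]
    have h2 (f g : H →ₗ[k] TensorAlgebra k H) (h : H) : TensorAlgebra.lift k π (conv f g h) =
        conv ((TensorAlgebra.lift k π).toLinearMap ∘ₗ f)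
          ((TensorAlgebra.lift k π).toLinearMap ∘ₗ g) h := by
      rw [← algHom_comp_conv]; rfl
    rintro _ _ (_ | ⟨h, x⟩ | ⟨h, x⟩)
    · simp [hπ.map_one]
    · rw [map_mul, h2, h2, h0, h1, h1, TensorAlgebra.lift_ι_apply, hπ.mul_conv]
    · rw [map_mul, h2, h2, h0, h1, h1, TensorAlgebra.lift_ι_apply, hπ.conv_mul]⟩

@[simp] theorem HPar.lift_bracket {B : Type*} [Ring B] [Algebra k B] {π : H →ₗ[k] B}
    (hπ : IsPartialRep π) (h : H) : HPar.lift hπ (HPar.bracket k H h) = π h := by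
  refine (RingQuot.liftAlgHom_mkAlgHom_apply k _ _ _).trans ?_
  simp

/-- A partial `H`-module: a `k`-module `M` with a partial representation of `H` on `End_k(M)`. -/
structure PMod where
  carrier : Type w
  [addCommGroup : AddCommGroup carrier]
  [module : Module k carrier]
  /-- `act h m` is `h • m` -/
  act : H →ₗ[k] Module.End k carrier
  isPartialRep : IsPartialRep act

attribute [instance] PMod.addCommGroup PMod.module

namespace PMod

instance : CoeSort (PMod.{u, v, w} k H) (Type w) := ⟨PMod.carrier⟩

variable {k H}

/-- The morphisms of partial modules, as a submodule of all linear maps. -/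
def homSubmodule (M : PMod.{u, v, w} k H) (N : PMod.{u, v, w'} k H) :
    Submodule k (M →ₗ[k] N) where
  carrier := {f | ∀ h m, f (M.act h m) = N.act h (f m)}
  add_mem' hf hg h m := by simp [hf h m, hg h m]
  zero_mem' h m := by simp
  smul_mem' c f hf h m := by simp [hf h m]

/-- The category of partial modules. -/
instance : CategoryTheory.Category (PMod.{u, v, w} k H) where
  Hom M N := homSubmodule M N
  id M := ⟨LinearMap.id, fun _ _ => rfl⟩
  comp f g := ⟨g.1 ∘ₗ f.1, fun h m => by
    rw [LinearMap.comp_apply, LinearMap.comp_apply, f.2, g.2]⟩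

/-- The tensor product `M ⊗ X` of a partial module and a (global) module, with the diagonal action
`h • (m ⊗ x) = h₍₁₎ • m ⊗ h₍₂₎ x`. -/
abbrev tensor (M : PMod.{u, v, w} k H) (X : Type w') [AddCommGroup X] [Module k X] [Module H X]
    [IsScalarTower k H X] : PMod.{u, v, max w w'} k H where
  carrier := M ⊗[k] X
  act := conv ((Module.End.rTensorAlgHom k M X).toLinearMap ∘ₗ M.act)
    ((Module.End.lTensorAlgHom k X M).comp (Algebra.lsmul k k X)).toLinearMap
  isPartialRep := by
    have h1 : IsPartialRep ((Module.End.rTensorAlgHom k M X).toLinearMap ∘ₗ M.act) :=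
      M.isPartialRep.comp_algHom _
    refine h1.conv_algHom _ fun x y => ?_
    exact TensorProduct.ext' fun m z => rfl

theorem tensor_act_tmul (M : PMod.{u, v, w} k H) (X : Type w') [AddCommGroup X] [Module k X]
    [Module H X] [IsScalarTower k H X] {ι : Type*} {h : H} (r : Repr k h ι) (m : M) (x : X) :
    (M.tensor X).act h (m ⊗ₜ[k] x) =
      ∑ i ∈ r.index, M.act (r.left i) m ⊗ₜ[k] (r.right i • x) := by
  rw [show (M.tensor X).act h = _ from conv_repr _ _ r]
  exact LinearMap.sum_apply _ _ _

/-- The action of `H_par` on a partial module. -/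
def parAct (M : PMod.{u, v, w} k H) : HPar k H →ₐ[k] Module.End k M := HPar.lift M.isPartialRep

variable (k H) in
/-- The partial module `A_par`: the subalgebra of `H_par` generated by the elements
`ε_h = [h₍₁₎][S(h₍₂₎)]`, with the action `h • a = [h₍₁₎] a [S(h₍₂₎)]`. -/
abbrev APar : PMod.{u, v, max u v} k H where
  carrier := epsAlg (HPar.bracket k H)
  act := (HPar.isPartialRep_bracket k H).epsAct
  isPartialRep := (HPar.isPartialRep_bracket k H).isPartialRep_epsAct

/-- The left action `a · m` of `A_par` on a partial module. -/
def aAct (M : PMod.{u, v, w} k H) : APar k H →ₗ[k] Module.End k M :=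
  M.parAct.toLinearMap ∘ₗ (epsAlg (HPar.bracket k H)).val.toLinearMap

/-- `Hom_k(H, M)` -/
def CoHom (M : PMod.{u, v, w} k H) : Type max v w := H →ₗ[k] M

instance (M : PMod.{u, v, w} k H) : AddCommGroup M.CoHom :=
  inferInstanceAs (AddCommGroup (H →ₗ[k] M))

instance (M : PMod.{u, v, w} k H) : FunLike M.CoHom H M :=
  inferInstanceAs (FunLike (H →ₗ[k] M) H M)

/-- The `H`-module structure `(h ⇀ f)(x) = f(xh)` on `Hom_k(H, M)`. -/
instance (M : PMod.{u, v, w} k H) : Module H M.CoHom where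
  smul h f := LinearMap.comp (show H →ₗ[k] M from f) (LinearMap.mulRight k h)
  one_smul f := LinearMap.ext fun x => congrArg f (mul_one x)
  mul_smul a b f := LinearMap.ext fun x => congrArg f (mul_assoc x a b).symm
  smul_zero _ := rfl
  smul_add _ _ _ := rfl
  add_smul a b f := LinearMap.ext fun x =>
    (congrArg f (mul_add x a b)).trans (map_add (show H →ₗ[k] M from f) _ _)
  zero_smul f := LinearMap.ext fun x =>
    (congrArg f (mul_zero x)).trans (map_zero (show H →ₗ[k] M from f))

theorem CoHom.smul_apply {M : PMod.{u, v, w} k H} (h : H) (f : M.CoHom) (x : H) :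
    (h • f) x = f (x * h) := rfl

/-- `φ(m)(h) = h • m` -/
def φ (M : PMod.{u, v, w} k H) (m : M) : M.CoHom := M.act.flip m

/-- The `H`-module `M̄` underlying the standard dilation: the `H`-submodule of `Hom_k(H, M)`
generated by `φ(M)`. -/
def dilation (M : PMod.{u, v, w} k H) : Submodule H M.CoHom :=
  Submodule.span H (Set.range M.φ)

/-- Composition with a morphism of partial modules, as a map `Hom_k(H, M) → Hom_k(H, N)`. -/
def coHomMap {M : PMod.{u, v, w} k H} {N : PMod.{u, v, w'} k H} (f : M →ₗ[k] N) :
    M.CoHom →ₗ[H] N.CoHom where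
  toFun x := LinearMap.comp f (show H →ₗ[k] M from x)
  map_add' _ _ := LinearMap.ext fun _ => map_add f _ _
  map_smul' _ _ := rfl

theorem coHomMap_mem {M : PMod.{u, v, w} k H} {N : PMod.{u, v, w'} k H} (f : homSubmodule M N)
    (x : M.CoHom) (hx : x ∈ M.dilation) : coHomMap f.1 x ∈ N.dilation := by
  have : M.dilation ≤ N.dilation.comap (coHomMap f.1) := by
    refine Submodule.span_le.2 ?_
    rintro _ ⟨m, rfl⟩
    refine Submodule.subset_span ⟨f.1 m, ?_⟩
    exact LinearMap.ext fun h => (f.2 h m).symm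
  exact this hx

/-- The Hom-object `{M, N} = Hom(M ⊗ H, N)`, the morphisms being those of partial modules. -/
def HomObj (M : PMod.{u, v, w} k H) (N : PMod.{u, v, w'} k H) : Type max v w w' :=
  homSubmodule (M.tensor H) N

instance (M : PMod.{u, v, w} k H) (N : PMod.{u, v, w'} k H) : AddCommGroup (HomObj M N) :=
  inferInstanceAs (AddCommGroup (homSubmodule (M.tensor H) N))

/-- `m ⊗ x ↦ m ⊗ xh` -/
def rightMul (M : PMod.{u, v, w} k H) (h : H) : M ⊗[k] H →ₗ[k] M ⊗[k] H :=
  (LinearMap.mulRight k h).lTensor M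

theorem rightMul_act (M : PMod.{u, v, w} k H) (h h' : H) (z : M ⊗[k] H) :
    M.rightMul h ((M.tensor H).act h' z) = (M.tensor H).act h' (M.rightMul h z) := by
  induction z with
  | zero => simp only [map_zero]
  | add y z hy hz => simp only [map_add, hy, hz]
  | tmul m x =>
    rw [rightMul, LinearMap.lTensor_tmul, tensor_act_tmul M H (ℛ k h'),
      tensor_act_tmul M H (ℛ k h'), map_sum]
    simp [mul_assoc]

/-- The `H`-module structure `(h ⇀ f)(m ⊗ x) = f(m ⊗ xh)` on `{M, N}`. -/
instance (M : PMod.{u, v, w} k H) (N : PMod.{u, v, w'} k H) : Module H (HomObj M N) where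
  smul h f := ⟨LinearMap.comp (Subtype.val f) (M.rightMul h), fun h' z =>
    (congrArg _ (M.rightMul_act h h' z)).trans (Subtype.prop f h' _)⟩
  one_smul f := Subtype.ext <| TensorProduct.ext' fun m x =>
    congrArg (fun y => Subtype.val f (m ⊗ₜ[k] y)) (mul_one x)
  mul_smul a b f := Subtype.ext <| TensorProduct.ext' fun m x =>
    congrArg (fun y => Subtype.val f (m ⊗ₜ[k] y)) (mul_assoc x a b).symm
  smul_zero _ := rfl
  smul_add _ _ _ := rfl
  add_smul a b f := Subtype.ext <| TensorProduct.ext' fun m x =>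
    (congrArg (fun y => Subtype.val f (m ⊗ₜ[k] y)) (mul_add x a b)).trans
      ((congrArg _ (TensorProduct.tmul_add m _ _)).trans (map_add (Subtype.val f) _ _))
  zero_smul f := Subtype.ext <| TensorProduct.ext' fun m x =>
    (congrArg (fun y => Subtype.val f (m ⊗ₜ[k] y)) (mul_zero x)).trans
      ((congrArg _ (TensorProduct.tmul_zero _ m)).trans (map_zero (Subtype.val f)))

theorem HomObj.smul_apply {M : PMod.{u, v, w} k H} {N : PMod.{u, v, w'} k H} (h : H)
    (f : HomObj M N) (m : M) (x : H) :
    (h • f).val (m ⊗ₜ[k] x) = f.val (m ⊗ₜ[k] (x * h)) := rfl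

/-- Composition with a morphism of partial modules, `{M, N} → {M, N'}`. -/
def homObjMap (M : PMod.{u, v, w} k H) {N : PMod.{u, v, w'} k H} {N' : PMod.{u, v, w''} k H}
    (f : homSubmodule N N') : HomObj M N →ₗ[H] HomObj M N' where
  toFun g := ⟨f.1 ∘ₗ g.val, fun h z => by
    rw [LinearMap.comp_apply, LinearMap.comp_apply, g.prop, f.2]⟩
  map_add' _ _ := Subtype.ext <| LinearMap.ext fun _ => map_add f.1 _ _
  map_smul' _ _ := rfl

/-- The linear map `a ⊗ x ↦ a · f(x)`, for a linear map `f : H → M`. -/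
def xiLin (M : PMod.{u, v, w} k H) (f : M.CoHom) : APar k H ⊗[k] H →ₗ[k] M :=
  TensorProduct.lift (M.aAct.compl₂ (show H →ₗ[k] M from f))

theorem xiLin_tmul (M : PMod.{u, v, w} k H) (f : M.CoHom) (a : APar k H) (x : H) :
    M.xiLin f (a ⊗ₜ x) = M.aAct a (f x) := rfl

theorem xiLin_φ_mem (M : PMod.{u, v, w} k H) (m : M) :
    M.xiLin (M.φ m) ∈ homSubmodule ((APar k H).tensor H) M := by
  intro h (z : APar k H ⊗[k] H)
  induction z with
  | zero => simp only [map_zero]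
  | add y z hy hz => simp only [map_add, hy, hz]
  | tmul a x =>
    have h1 := (HPar.isPartialRep_bracket k H).adj_conv_mulRight a.2 h x
    have h2 := congrArg (fun y => M.parAct y m) h1
    rw [tensor_act_tmul (APar k H) H (ℛ k h), map_sum]
    rw [conv_repr _ _ (ℛ k h)] at h2
    simp only [map_sum, LinearMap.sum_apply, map_mul, Module.End.mul_apply, LinearMap.comp_apply,
      parAct, HPar.lift_bracket, LinearMap.mulRight_apply] at h2
    exact h2

theorem xiLin_mem (M : PMod.{u, v, w} k H) (f : M.CoHom) (hf : f ∈ M.dilation) :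
    M.xiLin f ∈ homSubmodule ((APar k H).tensor H) M := by
  have hadd (x y : M.CoHom) : M.xiLin (x + y) = M.xiLin x + M.xiLin y :=
    TensorProduct.ext' fun a z => map_add (M.aAct a) (x z) (y z)
  induction hf using Submodule.span_induction with
  | mem x hx =>
    obtain ⟨m, rfl⟩ := hx
    exact M.xiLin_φ_mem m
  | zero =>
    have : M.xiLin 0 = 0 := TensorProduct.ext' fun a z => map_zero (M.aAct a)
    rw [this]
    exact zero_mem _
  | add x y _ _ hx hy =>
    rw [hadd]
    exact add_mem hx hy
  | smul h x _ hx =>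
    have : M.xiLin (h • x) = M.xiLin x ∘ₗ (APar k H).rightMul h :=
      TensorProduct.ext' fun a z => rfl
    rw [this]
    exact Subtype.prop (h • (show HomObj (APar k H) M from ⟨M.xiLin x, hx⟩))

/-- The map `Ξ_M : M̄ → {A_par, M}`, `Ξ_M(f)(a ⊗ x) = a · f(x)`. -/
def xiApp (M : PMod.{u, v, w} k H) : M.dilation →ₗ[H] HomObj (APar k H) M where
  toFun f := ⟨M.xiLin f.1, M.xiLin_mem f.1 f.2⟩
  map_add' x y := Subtype.ext <|
    TensorProduct.ext' fun a z => map_add (M.aAct a) (x.1 z) (y.1 z)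
  map_smul' _ _ := Subtype.ext <| TensorProduct.ext' fun _ _ => rfl

/-- `Ξ_M(∑ hᵢ ⇀ φ(mᵢ))(a ⊗ x) = a · ∑ (x hᵢ • mᵢ)` -/
theorem xiApp_sum (M : PMod.{u, v, w} k H) {ι : Type*} (s : Finset ι) (h : ι → H) (m : ι → M)
    (hs : ∑ i ∈ s, h i • M.φ (m i) ∈ M.dilation) (a : APar k H) (x : H) :
    (M.xiApp ⟨∑ i ∈ s, h i • M.φ (m i), hs⟩).val (a ⊗ₜ[k] x) =
      M.aAct a (∑ i ∈ s, M.act (x * h i) (m i)) := by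
  have (t : Finset ι) : (∑ i ∈ t, h i • M.φ (m i)) x = ∑ i ∈ t, M.act (x * h i) (m i) := by
    classical
    induction t using Finset.induction_on with
    | empty => rfl
    | insert i t hi ih =>
      rw [Finset.sum_insert hi, Finset.sum_insert hi, ← ih]
      rfl
  exact congrArg (M.aAct a) (this s)

theorem map_aAct {M : PMod.{u, v, w} k H} {N : PMod.{u, v, w'} k H} (f : homSubmodule M N)
    (a : APar k H) (m : M) : N.aAct a (f.1 m) = f.1 (M.aAct a m) := by
  have h0 (h : H) (m : M) : N.parAct (HPar.bracket k H h) (f.1 m) =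
      f.1 (M.parAct (HPar.bracket k H h) m) := by
    rw [parAct, parAct, HPar.lift_bracket, HPar.lift_bracket, f.2]
  have h1 : ∀ a ∈ epsAlg (HPar.bracket k H), ∀ m : M,
      N.parAct a (f.1 m) = f.1 (M.parAct a m) := by
    intro a ha
    induction ha using Algebra.adjoin_induction with
    | mem b hb =>
      obtain ⟨h, rfl⟩ := hb
      intro m
      rw [eps, conv_repr _ _ (ℛ k h)]
      simp [h0]
    | algebraMap r => intro m; simp
    | add a b _ _ ha hb => intro m; simp [ha, hb]
    | mul a b _ _ ha hb => intro m; simp [ha, hb]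
  exact h1 a.1 a.2 m

/-- `(h₍₁₎ • (S(h₍₂₎) • m)) = ε_h · m` -/
theorem aAct_eps (M : PMod.{u, v, w} k H) {ι : Type*} {h : H} (r : Repr k h ι) (m : M) :
    M.aAct ⟨eps (HPar.bracket k H) h, Algebra.subset_adjoin ⟨h, rfl⟩⟩ m =
      ∑ i ∈ r.index, M.act (r.left i) (M.act (HopfAlgebra.antipode k (r.right i)) m) := by
  have h1 : eps (HPar.bracket k H) h = _ := conv_repr _ _ r
  refine (congrArg (fun y => M.parAct y m) h1).trans ?_
  simp [parAct]

open CategoryTheory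

variable (k H)

/-- The dilation functor `D`, from partial modules to modules, `M ↦ M̄`. -/
def dilationFunctor : PMod.{u, v, max u v w} k H ⥤ ModuleCat.{max u v w} H where
  obj M := ModuleCat.of H M.dilation
  map f := ModuleCat.ofHom <| (coHomMap (Subtype.val f)).restrict
    fun x hx => coHomMap_mem f x hx
  map_id _ := rfl
  map_comp _ _ := rfl

/-- The functor `{A_par, -}` from partial modules to modules. -/
def homAParFunctor : PMod.{u, v, max u v w} k H ⥤ ModuleCat.{max u v w} H where
  obj M := ModuleCat.of H (HomObj (APar k H) M)
  map f := ModuleCat.ofHom (homObjMap (APar k H) f)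
  map_id _ := rfl
  map_comp _ _ := rfl

/-- The natural transformation `Ξ : D ⟶ {A_par, -}`. -/
def xi : dilationFunctor.{u, v, w} k H ⟶ homAParFunctor.{u, v, w} k H where
  app M := ModuleCat.ofHom M.xiApp
  naturality _ N f := by
    refine ModuleCat.hom_ext <| LinearMap.ext fun x => Subtype.ext <|
      TensorProduct.ext' fun a z => ?_
    exact map_aAct f a (x.1 z)

end PMod
end PartialModules

section Pointed

variable (k : Type u) {H : Type v} [Field k] [AddCommGroup H] [Module k H] [Coalgebra k H]

/-- A subcoalgebra: a subspace `C` with `Δ(C) ⊆ C ⊗ C`. -/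
def IsSubcoalgebra (C : Submodule k H) : Prop :=
  ∀ c ∈ C, comul c ∈ LinearMap.range (TensorProduct.map C.subtype C.subtype)

/-- A simple subcoalgebra: a nonzero subcoalgebra whose only subcoalgebras are `0` and itself. -/
structure IsSimpleSubcoalgebra (C : Submodule k H) : Prop where
  isSubcoalgebra : IsSubcoalgebra k C
  ne_bot : C ≠ ⊥
  eq_bot_or_eq (D : Submodule k H) : IsSubcoalgebra k D → D ≤ C → D = ⊥ ∨ D = C

variable (H) in
/-- A coalgebra is pointed if all its simple subcoalgebras are one-dimensional. -/
def IsPointed : Prop :=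
  ∀ C : Submodule k H, IsSimpleSubcoalgebra k C → Module.finrank k C = 1

end Pointed

end PartialHopf

end

/-!
A morphism `f : A_par ⊗ H → M` of partial modules is `A_par`-linear, because in
`h₍₁₎ • (S(h₍₂₎) • (a ⊗ x))` the legs of `h` that act on `x` cancel (`PMod.tensor_parAct_eps`). So
`f` is determined by the map `F(x) = f(1 ⊗ x)`, which satisfies
`h • F(y) = ε_{h₍₁₎} · F(h₍₂₎ y)` (`PMod.HomObj.act_apply_one_tmul`), and `Ξ_M` becomes the inclusion
of the dilation in the space of these maps. In particular it is injective.

For surjectivity, `f` is changed by elements of the image of `Ξ_M`, one grouplike element at a time: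
subtracting `Ξ_M(g⁻¹ ⇀ φ(F(g)))` replaces `F(x)` by `F(x) - x g⁻¹ • F(g)`, which vanishes at `x = g`,
and which still vanishes at every grouplike `g'` with `F(g') = 0`, because
`g' g⁻¹ • F(g) = ε_{g' g⁻¹} · F(g')`. As there are finitely many grouplike elements, it may be
assumed that `F` vanishes at all of them (`PMod.HomObj.exists_sub_mem_range_xiApp`).

Then `F = 0` (`PMod.HomObj.eq_zero_of_groupLike`). Otherwise let `W` be the largest left coideal all
of whose translates by grouplike elements lie in the kernel of `F`; it is proper. The comodule `H / W`
contains a simple subcomodule, and as `H` is pointed this is one-dimensional, so that there are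
`h ∉ W` and a grouplike `g` with `Δ(h) ≡ g ⊗ h` modulo `H ⊗ W`
(`IsPointed.exists_leftHit_sub_smul_mem`). For grouplike `y`, the identity for `F` at `h g⁻¹` and
`g y` reads `0 = h g⁻¹ • F(g y) = ε_1 · F(h y) = F(h y)`, so `W` and `h` together span a larger such
coideal, a contradiction.

Comodules are handled through the hit operators `c ↦ φ(c₍₁₎) c₍₂₎` for functionals `φ`: left coideals
are the submodules over the algebra `LeftHitAlg` that these operators generate.
-/

noncomputable section

namespace PartialHopf

/-! ### The hit actions of the dual of a coalgebra -/

section HitActions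

variable {k C : Type*} [CommRing k] [AddCommGroup C] [Module k C] [Coalgebra k C]

/-- The operator `c ↦ φ(c₍₁₎) c₍₂₎` attached to a functional `φ`. The subspaces stable under all of
these operators are the left coideals. -/
def leftHit (φ : Module.Dual k C) : Module.End k C :=
  (TensorProduct.lid k C).toLinearMap ∘ₗ φ.rTensor C ∘ₗ comul

/-- The operator `c ↦ φ(c₍₂₎) c₍₁₎` attached to a functional `φ`. -/
def rightHit (φ : Module.Dual k C) : Module.End k C :=
  (TensorProduct.rid k C).toLinearMap ∘ₗ φ.lTensor C ∘ₗ comul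

theorem leftHit_repr (φ : Module.Dual k C) {ι : Type*} {c : C} (r : Repr k c ι) :
    leftHit φ c = ∑ i ∈ r.index, φ (r.left i) • r.right i := by
  simp [leftHit, ← r.eq]

theorem rightHit_repr (φ : Module.Dual k C) {ι : Type*} {c : C} (r : Repr k c ι) :
    rightHit φ c = ∑ i ∈ r.index, φ (r.right i) • r.left i := by
  simp [rightHit, ← r.eq]

theorem leftHit_counit (c : C) : leftHit (counit (R := k)) c = c := by
  simp [leftHit]

theorem rightHit_counit (c : C) : rightHit (counit (R := k)) c = c := by
  simp [rightHit]

theorem apply_leftHit (χ φ : Module.Dual k C) (c : C) : χ (leftHit φ c) = φ (rightHit χ c) := by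
  rw [leftHit_repr φ (ℛ k c), rightHit_repr χ (ℛ k c)]
  simp [mul_comm]

theorem leftHit_rightHit (φ ψ : Module.Dual k C) (c : C) :
    leftHit φ (rightHit ψ c) = rightHit ψ (leftHit φ c) := by
  have h := congrArg (fun z => TensorProduct.lid k C
    (TensorProduct.map φ ((TensorProduct.rid k C).toLinearMap ∘ₗ ψ.lTensor C) z)) (coassoc_apply c)
  have key : ∀ z : C ⊗[k] C, TensorProduct.lid k C
      (TensorProduct.map φ ((TensorProduct.rid k C).toLinearMap ∘ₗ ψ.lTensor C)
        (TensorProduct.assoc k C C C (comul.rTensor C z))) =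
      leftHit φ (TensorProduct.rid k C (ψ.lTensor C z)) := by
    intro z
    induction z with
    | zero => simp
    | add y z hy hz => simp only [map_add, hy, hz]
    | tmul a b =>
      rw [LinearMap.rTensor_tmul, LinearMap.lTensor_tmul, TensorProduct.rid_tmul, map_smul,
        leftHit_repr φ (ℛ k a), ← (ℛ k a).eq]
      simp [TensorProduct.sum_tmul, Finset.smul_sum, smul_smul, mul_comm]
  have key' : ∀ z : C ⊗[k] C, TensorProduct.lid k C
      (TensorProduct.map φ ((TensorProduct.rid k C).toLinearMap ∘ₗ ψ.lTensor C)
        (comul.lTensor C z)) =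
      rightHit ψ (TensorProduct.lid k C (φ.rTensor C z)) := by
    intro z
    induction z with
    | zero => simp
    | add y z hy hz => simp only [map_add, hy, hz]
    | tmul a b => simp [rightHit]
  simp only [key, key'] at h
  exact h

theorem leftHit_isGroupLikeElem {g : C} (hg : IsGroupLikeElem k g) (φ : Module.Dual k C) :
    leftHit φ g = φ g • g := by
  simp [leftHit, hg.comul_eq_tmul_self]

end HitActions

section Field

variable {k C : Type*} [Field k] [AddCommGroup C] [Module k C] [Coalgebra k C]

/-- Functionals on the first tensor factor separate the elements of a tensor product. -/
theorem eq_zero_of_forall_rTensor {V N : Type*} [AddCommGroup V] [Module k V] [AddCommGroup N]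
    [Module k N] (z : V ⊗[k] N)
    (h : ∀ φ : Module.Dual k V, TensorProduct.lid k N (φ.rTensor N z) = 0) : z = 0 := by
  classical
  let b := Module.Basis.ofVectorSpace k V
  refine (TensorProduct.equivFinsuppOfBasisLeft b (N := N)).injective ?_
  rw [map_zero]
  ext i
  rw [Finsupp.zero_apply, ← h (b.coord i)]
  clear h
  induction z with
  | zero => simp
  | add y z hy hz => simp only [map_add, Finsupp.add_apply, hy, hz]
  | tmul a n => simp

theorem eq_zero_of_forall_lTensor {V N : Type*} [AddCommGroup V] [Module k V] [AddCommGroup N]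
    [Module k N] (z : V ⊗[k] N)
    (h : ∀ φ : Module.Dual k N, TensorProduct.rid k V (φ.lTensor V z) = 0) : z = 0 := by
  refine (TensorProduct.comm k V N).injective ?_
  rw [map_zero]
  refine eq_zero_of_forall_rTensor _ fun φ => ?_
  rw [← h φ]
  clear h
  induction z with
  | zero => simp
  | add y z hy hz => simp only [map_add, hy, hz]
  | tmul a n => simp

theorem eq_of_forall_dual {V : Type*} [AddCommGroup V] [Module k V] {x y : V}
    (h : ∀ χ : Module.Dual k V, χ x = χ y) : x = y :=
  sub_eq_zero.1 <| (Module.forall_dual_apply_eq_zero_iff k _).1 fun χ => by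
    rw [map_sub, h, sub_self]

theorem leftHit_leftHit (φ ψ : Module.Dual k C) (c : C) :
    leftHit φ (leftHit ψ c) = leftHit (ψ ∘ₗ rightHit φ) c := by
  refine eq_of_forall_dual (k := k) fun χ => ?_
  rw [apply_leftHit, ← leftHit_rightHit, apply_leftHit, apply_leftHit, LinearMap.comp_apply]

theorem rightHit_rightHit (φ ψ : Module.Dual k C) (c : C) :
    rightHit φ (rightHit ψ c) = rightHit (ψ ∘ₗ leftHit φ) c := by
  refine eq_of_forall_dual (k := k) fun χ => ?_
  rw [← apply_leftHit, leftHit_rightHit, ← apply_leftHit, ← apply_leftHit, LinearMap.comp_apply]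

/-! ### Subcoalgebras and grouplike elements -/

theorem IsSubcoalgebra.leftHit_mem {D : Submodule k C} (hD : IsSubcoalgebra k D)
    (φ : Module.Dual k C) {c : C} (hc : c ∈ D) : leftHit φ c ∈ D := by
  obtain ⟨t, ht⟩ := hD c hc
  rw [leftHit, LinearMap.comp_apply, LinearMap.comp_apply, ← ht]
  clear ht
  induction t with
  | zero => simp
  | add y z hy hz => simp only [map_add] at hy hz ⊢; exact add_mem hy hz
  | tmul a b => simpa using D.smul_mem _ b.2

theorem IsSubcoalgebra.rightHit_mem {D : Submodule k C} (hD : IsSubcoalgebra k D)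
    (φ : Module.Dual k C) {c : C} (hc : c ∈ D) : rightHit φ c ∈ D := by
  obtain ⟨t, ht⟩ := hD c hc
  rw [rightHit, LinearMap.comp_apply, LinearMap.comp_apply, ← ht]
  clear ht
  induction t with
  | zero => simp
  | add y z hy hz => simp only [map_add] at hy hz ⊢; exact add_mem hy hz
  | tmul a b => simpa using D.smul_mem _ a.2

/-- A subspace stable under both hit actions is a subcoalgebra. -/
theorem isSubcoalgebra_of_hit_mem {D : Submodule k C}
    (hl : ∀ (φ : Module.Dual k C), ∀ c ∈ D, leftHit φ c ∈ D)
    (hr : ∀ (φ : Module.Dual k C), ∀ c ∈ D, rightHit φ c ∈ D) : IsSubcoalgebra k D := by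
  intro c hc
  obtain ⟨p, hp⟩ := LinearMap.exists_leftInverse_of_injective D.subtype D.ker_subtype
  have hpD : ∀ d ∈ D, (p d : C) = d := fun d hd =>
    congrArg Subtype.val (LinearMap.congr_fun hp ⟨d, hd⟩)
  have h1 : (D.subtype ∘ₗ p).lTensor C (comul (R := k) c) = comul c := by
    rw [← sub_eq_zero]
    refine eq_zero_of_forall_rTensor _ fun φ => ?_
    have h2 : ∀ z : C ⊗[k] C, TensorProduct.lid k C (φ.rTensor C ((D.subtype ∘ₗ p).lTensor C z)) =
        p (TensorProduct.lid k C (φ.rTensor C z)) := fun z => by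
      induction z with
      | zero => simp
      | add y z hy hz => simp only [map_add, hy, hz, Submodule.coe_add]
      | tmul a b => simp
    rw [map_sub, map_sub, h2, sub_eq_zero]
    exact hpD _ (hl φ c hc)
  have h2 : (D.subtype ∘ₗ p).rTensor C (comul (R := k) c) = comul c := by
    rw [← sub_eq_zero]
    refine eq_zero_of_forall_lTensor _ fun φ => ?_
    have h2 : ∀ z : C ⊗[k] C, TensorProduct.rid k C (φ.lTensor C ((D.subtype ∘ₗ p).rTensor C z)) =
        p (TensorProduct.rid k C (φ.lTensor C z)) := fun z => by
      induction z with
      | zero => simp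
      | add y z hy hz => simp only [map_add, hy, hz, Submodule.coe_add]
      | tmul a b => simp
    rw [map_sub, map_sub, h2, sub_eq_zero]
    exact hpD _ (hr φ c hc)
  refine ⟨TensorProduct.map p p (comul c), ?_⟩
  rw [← LinearMap.comp_apply, ← TensorProduct.map_comp, ← LinearMap.rTensor_comp_lTensor,
    LinearMap.comp_apply, h1, h2]

/-- Local finiteness: every element of a coalgebra lies in a finite-dimensional subcoalgebra. -/
theorem exists_finiteDimensional_isSubcoalgebra (c : C) :
    ∃ D : Submodule k C, c ∈ D ∧ FiniteDimensional k D ∧ IsSubcoalgebra k D := by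
  classical
  let D : Submodule k C :=
    Submodule.span k (Set.range fun x : Module.Dual k C × Module.Dual k C =>
      rightHit x.1 (leftHit x.2 c))
  refine ⟨D, Submodule.subset_span ⟨(counit, counit), by simp [leftHit_counit, rightHit_counit]⟩,
    ?_, isSubcoalgebra_of_hit_mem ?_ ?_⟩
  · let r := ℛ k c
    let T : Finset C := r.index.biUnion fun i =>
      (ℛ k (r.right i)).index.image (ℛ k (r.right i)).left
    have hT : D ≤ Submodule.span k (T : Set C) := by
      refine Submodule.span_le.2 ?_
      rintro _ ⟨⟨ψ, φ⟩, rfl⟩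
      simp only [leftHit_repr φ r, map_sum, map_smul]
      refine Submodule.sum_mem _ fun i hi => Submodule.smul_mem _ _ ?_
      rw [rightHit_repr ψ (ℛ k (r.right i))]
      refine Submodule.sum_mem _ fun j hj => Submodule.smul_mem _ _ (Submodule.subset_span ?_)
      exact Finset.mem_coe.2 (Finset.mem_biUnion.2 ⟨i, hi, Finset.mem_image_of_mem _ hj⟩)
    exact Submodule.finiteDimensional_of_le hT
  · intro φ x hx
    refine (Submodule.span_le.2 ?_ : D ≤ D.comap (leftHit φ)) hx
    rintro _ ⟨⟨ψ, χ⟩, rfl⟩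
    refine Submodule.subset_span ⟨(ψ, χ ∘ₗ rightHit φ), ?_⟩
    simp only [leftHit_rightHit, leftHit_leftHit]
  · intro φ x hx
    refine (Submodule.span_le.2 ?_ : D ≤ D.comap (rightHit φ)) hx
    rintro _ ⟨⟨ψ, χ⟩, rfl⟩
    refine Submodule.subset_span ⟨(ψ ∘ₗ leftHit φ, χ), ?_⟩
    simp only [rightHit_rightHit]

theorem IsSubcoalgebra.inf {D E : Submodule k C} (hD : IsSubcoalgebra k D)
    (hE : IsSubcoalgebra k E) : IsSubcoalgebra k (D ⊓ E) :=
  isSubcoalgebra_of_hit_mem (fun φ _ hc => ⟨hD.leftHit_mem φ hc.1, hE.leftHit_mem φ hc.2⟩)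
    fun φ _ hc => ⟨hD.rightHit_mem φ hc.1, hE.rightHit_mem φ hc.2⟩

theorem IsSubcoalgebra.exists_isSimpleSubcoalgebra_le {D : Submodule k C}
    (hD : IsSubcoalgebra k D) (hD0 : D ≠ ⊥) : ∃ E ≤ D, IsSimpleSubcoalgebra k E := by
  classical
  have hex : ∃ n, ∃ E ≤ D, IsSubcoalgebra k E ∧ E ≠ ⊥ ∧ FiniteDimensional k E ∧
      Module.finrank k E = n := by
    obtain ⟨c, hc, hc0⟩ := D.ne_bot_iff.1 hD0
    obtain ⟨F, hcF, hF, hF'⟩ := exists_finiteDimensional_isSubcoalgebra (k := k) c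
    exact ⟨_, D ⊓ F, inf_le_left, hD.inf hF', (Submodule.ne_bot_iff _).2 ⟨c, ⟨hc, hcF⟩, hc0⟩,
      Submodule.finiteDimensional_of_le inf_le_right, rfl⟩
  obtain ⟨E, hED, hE, hE0, hEf, hEn⟩ := Nat.find_spec hex
  refine ⟨E, hED, hE, hE0, fun F hF hFE => or_iff_not_imp_left.2 fun hF0 => ?_⟩
  refine Submodule.eq_of_le_of_finrank_le hFE ?_
  rw [hEn]
  exact Nat.find_min' hex ⟨F, hFE.trans hED, hF, hF0, Submodule.finiteDimensional_of_le hFE, rfl⟩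

theorem IsSubcoalgebra.exists_isGroupLikeElem_mem {D : Submodule k C} (hD : IsSubcoalgebra k D)
    (h1 : Module.finrank k D = 1) : ∃ g ∈ D, IsGroupLikeElem k g := by
  obtain ⟨v, hv0, hv⟩ := finrank_eq_one_iff'.1 h1
  obtain ⟨t, ht⟩ := hD v v.2
  have hμ : ∃ μ : k, comul (R := k) (v : C) = μ • ((v : C) ⊗ₜ[k] (v : C)) := by
    rw [← ht]
    clear ht
    induction t with
    | zero => exact ⟨0, by simp⟩
    | add y z hy hz =>
      obtain ⟨a, ha⟩ := hy
      obtain ⟨b, hb⟩ := hz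
      exact ⟨a + b, by rw [map_add, ha, hb, add_smul]⟩
    | tmul a b =>
      obtain ⟨x, rfl⟩ := hv a
      obtain ⟨y, rfl⟩ := hv b
      exact ⟨x * y, by simp [← TensorProduct.smul_tmul', smul_smul, mul_comm]⟩
  obtain ⟨μ, hμ⟩ := hμ
  have hv0' : (v : C) ≠ 0 := fun h => hv0 (Subtype.ext h)
  have h2 : μ * counit (R := k) (v : C) = 1 := by
    have h3 := leftHit_counit (k := k) (v : C)
    rw [leftHit, LinearMap.comp_apply, LinearMap.comp_apply, hμ] at h3
    simp only [map_smul, LinearMap.rTensor_tmul, LinearEquiv.coe_coe, TensorProduct.lid_tmul,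
      smul_smul] at h3
    exact smul_left_injective k hv0' (h3.trans (one_smul k _).symm)
  refine ⟨μ • (v : C), D.smul_mem _ v.2, ?_, ?_⟩
  · rw [map_smul, smul_eq_mul, h2]
  · rw [map_smul, hμ, TensorProduct.smul_tmul_smul, smul_smul]

theorem IsPointed.exists_isGroupLikeElem_mem (hC : IsPointed k C) {D : Submodule k C}
    (hD : IsSubcoalgebra k D) (hD0 : D ≠ ⊥) : ∃ g ∈ D, IsGroupLikeElem k g := by
  obtain ⟨E, hED, hE⟩ := hD.exists_isSimpleSubcoalgebra_le hD0
  obtain ⟨g, hg, hg'⟩ := hE.isSubcoalgebra.exists_isGroupLikeElem_mem (hC E hE)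
  exact ⟨g, hED hg, hg'⟩

/-! ### Left coideals of a pointed coalgebra -/

variable (k C) in
/-- The algebra of operators on a coalgebra generated by the left hit operators. Its submodules are
the left coideals. -/
def LeftHitAlg : Type _ := Algebra.adjoin k (Set.range (leftHit (k := k) (C := C)))

instance : Ring (LeftHitAlg k C) :=
  inferInstanceAs (Ring (Algebra.adjoin k (Set.range (leftHit (k := k) (C := C)))))

instance : Algebra k (LeftHitAlg k C) :=
  inferInstanceAs (Algebra k (Algebra.adjoin k (Set.range (leftHit (k := k) (C := C)))))

instance : Module (LeftHitAlg k C) C :=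
  inferInstanceAs (Module (Algebra.adjoin k (Set.range (leftHit (k := k) (C := C)))) C)

instance : IsScalarTower k (LeftHitAlg k C) C :=
  inferInstanceAs (IsScalarTower k (Algebra.adjoin k (Set.range (leftHit (k := k) (C := C)))) C)

/-- The left hit operator of a functional, as an element of `LeftHitAlg k C`. -/
def LeftHitAlg.of (φ : Module.Dual k C) : LeftHitAlg k C :=
  ⟨leftHit φ, Algebra.subset_adjoin ⟨φ, rfl⟩⟩

theorem smul_mem_of_leftHit_mem {W : Submodule k C}
    (hW : ∀ (φ : Module.Dual k C), ∀ c ∈ W, leftHit φ c ∈ W) (r : LeftHitAlg k C) :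
    ∀ c ∈ W, r • c ∈ W := by
  obtain ⟨r, hr⟩ := r
  change ∀ c ∈ W, r c ∈ W
  induction hr using Algebra.adjoin_induction with
  | mem x hx => obtain ⟨φ, rfl⟩ := hx; exact hW φ
  | algebraMap a => exact fun c hc => W.smul_mem a hc
  | add a b _ _ ha hb => exact fun c hc => add_mem (ha c hc) (hb c hc)
  | mul a b _ _ ha hb => exact fun c hc => ha _ (hb c hc)

/-- A subspace stable under the left hit action, as a submodule over `LeftHitAlg`. -/
def leftCoideal (W : Submodule k C) (hW : ∀ (φ : Module.Dual k C), ∀ c ∈ W, leftHit φ c ∈ W) :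
    Submodule (LeftHitAlg k C) C where
  toAddSubmonoid := W.toAddSubmonoid
  smul_mem' r c hc := smul_mem_of_leftHit_mem hW r c hc

theorem leftHit_mem (W : Submodule (LeftHitAlg k C) C) (φ : Module.Dual k C) {c : C} (hc : c ∈ W) :
    leftHit φ c ∈ W :=
  W.smul_mem (.of φ) hc

/-- The right hit operators are morphisms of left comodules. -/
def rightHitHom (f : Module.Dual k C) : C →ₗ[LeftHitAlg k C] C where
  toFun := rightHit f
  map_add' := map_add _
  map_smul' := by
    rintro ⟨r, hr⟩
    change ∀ c, rightHit f (r c) = r (rightHit f c)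
    induction hr using Algebra.adjoin_induction with
    | mem x hx => obtain ⟨φ, rfl⟩ := hx; exact fun c => (leftHit_rightHit φ f c).symm
    | algebraMap a => exact fun c => map_smul (rightHit f) a c
    | add a b _ _ ha hb => intro c; simp [ha, hb]
    | mul a b _ _ ha hb => intro c; simp [ha, hb]

theorem isSimpleModule_submodule_congr {R M N : Type*} [Ring R] [AddCommGroup M] [Module R M]
    [AddCommGroup N] [Module R N] {S : Submodule R M} {T : Submodule R N}
    (hS : IsSimpleModule R S) (e : S ≃ₗ[R] T) : IsSimpleModule R T :=
  IsSimpleModule.congr (N := S) e.symm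

/-- The nonzero comodule `C / W` contains a simple one, by local finiteness. -/
theorem exists_isSimpleModule_quotient (W : Submodule (LeftHitAlg k C) C) (hW : W ≠ ⊤) :
    ∃ S : Submodule (LeftHitAlg k C) (C ⧸ W), IsSimpleModule (LeftHitAlg k C) S := by
  obtain ⟨c, -, hc⟩ := SetLike.exists_of_lt hW.lt_top
  obtain ⟨D, hcD, hD, hD'⟩ := exists_finiteDimensional_isSubcoalgebra (k := k) c
  let D₁ := leftCoideal D fun φ _ hx => hD'.leftHit_mem φ hx
  let N := D₁.map W.mkQ
  have : Module.Finite k D₁ := hD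
  have : Module.Finite k N := Module.Finite.of_surjective
    ((W.mkQ.submoduleMap D₁).restrictScalars k) (W.mkQ.submoduleMap_surjective D₁)
  have : IsArtinian (LeftHitAlg k C) N := isArtinian_of_tower k inferInstance
  have : Nontrivial N := by
    refine ⟨⟨⟨W.mkQ c, ⟨c, hcD, rfl⟩⟩, 0, fun h => hc ?_⟩⟩
    exact (Submodule.Quotient.mk_eq_zero W).1 (congrArg Subtype.val h)
  obtain ⟨S, hS⟩ := IsAtomic.exists_atom (Submodule (LeftHitAlg k C) N)
  have := isSimpleModule_iff_isAtom.2 hS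
  exact ⟨S.map N.subtype,
    isSimpleModule_submodule_congr this (S.equivMapOfInjective _ N.subtype_injective)⟩

/-- Every simple left coideal of a pointed coalgebra is spanned by a vector on which the left hit
action is given by a grouplike element: the subcoalgebra generated by the coideal `U` is a sum of
homomorphic images of `U`, and contains a grouplike element. -/
theorem IsPointed.exists_linearEquiv_span (hC : IsPointed k C) (U : Submodule (LeftHitAlg k C) C)
    [IsSimpleModule (LeftHitAlg k C) U] : ∃ g : C, IsGroupLikeElem k g ∧
      Nonempty (Submodule.span (LeftHitAlg k C) {g} ≃ₗ[LeftHitAlg k C] U) := by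
  let s : Set (Submodule (LeftHitAlg k C) C) :=
    Set.range fun f : Module.Dual k C => U.map (rightHitHom f)
  have hUs : U ≤ sSup s := by
    refine le_trans ?_ (le_sSup ⟨counit, rfl⟩)
    exact fun u hu => ⟨u, hu, rightHit_counit u⟩
  have hs (m : s) : IsSemisimpleModule (LeftHitAlg k C) m := by
    obtain ⟨_, f, rfl⟩ := m
    have h := IsSemisimpleModule.range (rightHitHom f ∘ₗ U.subtype)
    rw [LinearMap.range_comp, Submodule.range_subtype] at h
    exact h
  have hD : IsSubcoalgebra k ((sSup s).restrictScalars k) := by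
    refine isSubcoalgebra_of_hit_mem (fun φ c hc => leftHit_mem (sSup s) φ hc) fun φ c hc => ?_
    refine (sSup_le ?_ : sSup s ≤ (sSup s).comap (rightHitHom φ)) hc
    rintro _ ⟨f, rfl⟩ _ ⟨u, hu, rfl⟩
    have hle : U.map (rightHitHom (f ∘ₗ leftHit φ)) ≤ sSup s := le_sSup ⟨_, rfl⟩
    exact hle ⟨u, hu, (rightHit_rightHit φ f u).symm⟩
  have hU0 : U ≠ ⊥ := (isSimpleModule_iff_isAtom.1 inferInstance).1
  obtain ⟨g, hgD, hg⟩ := hC.exists_isGroupLikeElem_mem hD <| by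
    obtain ⟨u, hu, hu0⟩ := U.ne_bot_iff.1 hU0
    exact (Submodule.ne_bot_iff _).2 ⟨u, hUs hu, hu0⟩
  refine ⟨g, hg, ?_⟩
  have hsimple : IsSimpleModule (LeftHitAlg k C) (Submodule.span (LeftHitAlg k C) {g}) := by
    rw [isSimpleModule_iff_isAtom]
    have hmem (x) (hx : x ∈ Submodule.span (LeftHitAlg k C) {g}) : ∃ a : k, a • g = x := by
      have hst : ∀ (φ : Module.Dual k C), ∀ c ∈ Submodule.span k {g}, leftHit φ c ∈
          Submodule.span k {g} := by
        intro φ c hc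
        obtain ⟨a, rfl⟩ := Submodule.mem_span_singleton.1 hc
        rw [map_smul, leftHit_isGroupLikeElem hg]
        exact Submodule.smul_mem _ _ (Submodule.smul_mem _ _ (Submodule.mem_span_singleton_self g))
      have : Submodule.span (LeftHitAlg k C) {g} ≤ leftCoideal (Submodule.span k {g}) hst :=
        Submodule.span_le.2 (Set.singleton_subset_iff.2 (Submodule.mem_span_singleton_self g))
      exact Submodule.mem_span_singleton.1 (this hx)
    refine ⟨fun h => hg.ne_zero (Submodule.span_singleton_eq_bot.1 h), fun V hV => ?_⟩
    by_contra hV0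
    obtain ⟨x, hx, hx0⟩ := V.ne_bot_iff.1 hV0
    obtain ⟨a, rfl⟩ := hmem x (hV.le hx)
    have ha : a ≠ 0 := fun h => hx0 (by rw [h, zero_smul])
    refine hV.not_ge (Submodule.span_le.2 (Set.singleton_subset_iff.2 ?_))
    have := (V.restrictScalars k).smul_mem a⁻¹ hx
    rwa [smul_smul, inv_mul_cancel₀ ha, one_smul] at this
  obtain ⟨_, ⟨f, rfl⟩, T, hT, ⟨e⟩⟩ := Submodule.le_linearEquiv_of_le_sSup
    (Submodule.span (LeftHitAlg k C) {g}) s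
    (Submodule.span_le.2 (Set.singleton_subset_iff.2 hgD))
  -- `T` is a nonzero submodule of the image of the simple module `U`, so it is isomorphic to `U`.
  let F : U →ₗ[LeftHitAlg k C] C := rightHitHom f ∘ₗ U.subtype
  have hT0 : T ≠ ⊥ := (isSimpleModule_iff_isAtom.1 (isSimpleModule_submodule_congr hsimple e)).1
  have hF : Function.Injective F := by
    refine F.injective_or_eq_zero.resolve_right fun h => hT0 ((Submodule.eq_bot_iff _).2 ?_)
    intro x hx
    obtain ⟨u, hu, rfl⟩ := hT hx
    exact LinearMap.congr_fun h ⟨u, hu⟩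
  have hFU : LinearMap.range F = U.map (rightHitHom f) := by
    rw [LinearMap.range_comp, Submodule.range_subtype]
  let e' : U ≃ₗ[LeftHitAlg k C] LinearMap.range F := LinearEquiv.ofInjective F hF
  have hA := isSimpleModule_iff_isAtom.1 (IsSimpleModule.congr (N := U) e'.symm)
  have hTF : T = LinearMap.range F := ((hA.le_iff_eq hT0).1 (hFU ▸ hT))
  exact ⟨(e.trans (LinearEquiv.ofEq _ _ hTF)).trans e'.symm⟩

/-- Every proper left coideal `W` of a pointed coalgebra is extended by a vector `h` with
`Δ(h) ≡ g ⊗ h` modulo `W` in the second factor, for some grouplike element `g`. -/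
theorem IsPointed.exists_leftHit_sub_smul_mem (hC : IsPointed k C)
    (W : Submodule (LeftHitAlg k C) C) (hW : W ≠ ⊤) :
    ∃ h ∉ W, ∃ g : C, IsGroupLikeElem k g ∧
      ∀ φ : Module.Dual k C, leftHit φ h - φ g • h ∈ W := by
  obtain ⟨S, hS⟩ := exists_isSimpleModule_quotient W hW
  obtain ⟨s, hs, hs0⟩ := S.ne_bot_iff.1 (isSimpleModule_iff_isAtom.1 hS).1
  obtain ⟨f', hf'⟩ := not_forall.1 (mt (Module.forall_dual_apply_eq_zero_iff k s).1 hs0)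
  -- A functional on the quotient by `W` that does not vanish on `S` embeds `S` into the coalgebra.
  let f : Module.Dual k C := f' ∘ₗ W.mkQ.restrictScalars k
  have hWf : W ≤ LinearMap.ker (rightHitHom f) := by
    intro x hx
    refine eq_of_forall_dual (k := k) fun χ => ?_
    change χ (rightHit f x) = χ 0
    rw [← apply_leftHit, map_zero]
    have : W.mkQ (leftHit χ x) = 0 := (Submodule.Quotient.mk_eq_zero W).2 (leftHit_mem W χ hx)
    change f' (W.mkQ (leftHit χ x)) = 0
    rw [this, map_zero]
  let F : S →ₗ[LeftHitAlg k C] C := W.liftQ (rightHitHom f) hWf ∘ₗ S.subtype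
  have hF : Function.Injective F := by
    refine F.injective_or_eq_zero.resolve_right fun h => hf' ?_
    obtain ⟨c, rfl⟩ := W.mkQ_surjective s
    have h1 : rightHit f c = 0 := LinearMap.congr_fun h ⟨_, hs⟩
    have h2 := apply_leftHit (k := k) f counit c
    rw [h1, map_zero, leftHit_counit] at h2
    exact h2
  let e' : S ≃ₗ[LeftHitAlg k C] LinearMap.range F := LinearEquiv.ofInjective F hF
  have := isSimpleModule_submodule_congr hS e'
  obtain ⟨g, hg, ⟨e⟩⟩ := hC.exists_linearEquiv_span (LinearMap.range F)
  let E := e.trans e'.symm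
  let g' : Submodule.span (LeftHitAlg k C) {g} := ⟨g, Submodule.mem_span_singleton_self g⟩
  obtain ⟨h, hh⟩ := W.mkQ_surjective (E g' : C ⧸ W)
  refine ⟨h, fun hW => ?_, g, hg, fun φ => ?_⟩
  · have h1 : (E g' : C ⧸ W) = 0 := hh.symm.trans ((Submodule.Quotient.mk_eq_zero W).2 hW)
    have h2 : g' = 0 := E.map_eq_zero_iff.1 (Subtype.ext h1)
    exact hg.ne_zero (congrArg Subtype.val h2)
  · have h1 : LeftHitAlg.of φ • g' = algebraMap k (LeftHitAlg k C) (φ g) • g' := by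
      refine Subtype.ext ?_
      rw [Submodule.coe_smul, Submodule.coe_smul, algebraMap_smul]
      exact leftHit_isGroupLikeElem hg φ
    have h2 := congrArg (fun x => (E x : C ⧸ W)) h1
    simp only [map_smul, Submodule.coe_smul, ← hh] at h2
    rw [← map_smul, ← map_smul, ← sub_eq_zero, ← map_sub, algebraMap_smul] at h2
    exact (Submodule.Quotient.mk_eq_zero W).1 h2

end Field

/-! ### Morphisms out of `A_par ⊗ H` -/

namespace PMod

section CommRing

variable {k : Type u} {H : Type v} [CommRing k] [Ring H] [HopfAlgebra k H]

/-- The element `ε_h = [h₍₁₎][S(h₍₂₎)]` of `A_par`. -/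
def epsElem (h : H) : APar k H :=
  ⟨eps (HPar.bracket k H) h, Algebra.subset_adjoin ⟨h, rfl⟩⟩

/-- On `A_par`, the operator `a ↦ h₍₁₎ • (S(h₍₂₎) • a)` is left multiplication by `ε_h`. -/
theorem epsElem_conv (h : H) :
    conv (APar k H).act ((APar k H).act ∘ₗ HopfAlgebra.antipode k) h =
      LinearMap.mulLeft k (epsElem (k := k) h) := by
  refine LinearMap.ext fun a => Subtype.ext ?_
  have h1 := (HPar.isPartialRep_bracket k H).coe_epsAct_conv LinearMap.id
    (HopfAlgebra.antipode k) h a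
  rw [LinearMap.comp_id, LinearMap.comp_id] at h1
  exact h1.trans ((HPar.isPartialRep_bracket k H).adj_conv_antipode a.2 h)

theorem epsElem_one : epsElem (k := k) (1 : H) = (1 : epsAlg (HPar.bracket k H)) := by
  refine Subtype.ext ?_
  have h1 := (HPar.isPartialRep_bracket k H).map_one
  change eps (HPar.bracket k H) 1 = 1
  rw [eps, conv_one, LinearMap.comp_apply, HopfAlgebra.antipode_one, h1, mul_one]

theorem parAct_eps (M : PMod.{u, v, w} k H) (h : H) :
    M.parAct (eps (HPar.bracket k H) h) =
      conv M.act (M.act ∘ₗ HopfAlgebra.antipode k) h := by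
  have h0 : M.parAct.toLinearMap ∘ₗ HPar.bracket k H = M.act :=
    LinearMap.ext fun x => HPar.lift_bracket k H M.isPartialRep x
  rw [eps, ← AlgHom.toLinearMap_apply, ← LinearMap.comp_apply, algHom_comp_conv,
    ← LinearMap.comp_assoc, h0]

/-- The action of `ε_h` on `M ⊗ H` only involves the first factor: in `h₍₁₎ • (S(h₍₂₎) • z)` the
legs of `h` acting on the global factor cancel. -/
theorem tensor_parAct_eps (M : PMod.{u, v, w} k H) (h : H) :
    (M.tensor H).parAct (eps (HPar.bracket k H) h) =
      (M.parAct (eps (HPar.bracket k H) h)).rTensor H := by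
  let β : H →ₐ[k] Module.End k (M ⊗[k] H) :=
    (Module.End.lTensorAlgHom k H M).comp (Algebra.lsmul k k H)
  let α : H →ₗ[k] Module.End k (M ⊗[k] H) :=
    (Module.End.rTensorAlgHom k M H).toLinearMap ∘ₗ M.act
  have hc : ∀ x y, Commute (α x) (β y) := fun x y => TensorProduct.ext' fun m z => rfl
  have hβ : conv β.toLinearMap (β.toLinearMap ∘ₗ HopfAlgebra.antipode k) = cst 1 := by
    have := algHom_comp_conv β LinearMap.id (HopfAlgebra.antipode k)
    rw [id_conv_antipode, comp_cst, LinearMap.comp_id] at this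
    rw [← this]; simp
  have hα : conv (conv α β.toLinearMap) (conv α β.toLinearMap ∘ₗ HopfAlgebra.antipode k) =
      conv α (α ∘ₗ HopfAlgebra.antipode k) := by
    rw [conv_comp_antipode _ _ hc, conv_assoc, ← conv_assoc β.toLinearMap, hβ, cst_one_conv]
  rw [parAct_eps, parAct_eps]
  refine (LinearMap.congr_fun hα h).trans ?_
  have := algHom_comp_conv (Module.End.rTensorAlgHom k M H) M.act
    (M.act ∘ₗ HopfAlgebra.antipode k)
  exact (LinearMap.congr_fun this h).symm

theorem aAct_tmul (a b : APar k H) (x : H) :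
    ((APar k H).tensor H).aAct a (b ⊗ₜ[k] x) =
      (show epsAlg (HPar.bracket k H) from a * b) ⊗ₜ[k] x := by
  obtain ⟨a, ha⟩ := a
  change ((APar k H).tensor H).parAct a (b ⊗ₜ[k] x) = _
  induction ha using Algebra.adjoin_induction generalizing b with
  | mem y hy =>
    obtain ⟨h, rfl⟩ := hy
    rw [tensor_parAct_eps, parAct_eps, epsElem_conv]
    rfl
  | algebraMap r =>
    rw [AlgHom.commutes]
    change r • b ⊗ₜ[k] x = _
    rw [TensorProduct.smul_tmul']
    rfl
  | add y z hy hz ihy ihz =>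
    rw [map_add, LinearMap.add_apply, ihy, ihz, ← TensorProduct.add_tmul]
    congr 1
    exact Subtype.ext (add_mul y z (b : HPar k H)).symm
  | mul y z hy hz ihy ihz =>
    rw [map_mul, Module.End.mul_apply, ihz, ihy]
    congr 1
    exact Subtype.ext (mul_assoc y z (b : HPar k H)).symm

/-- A morphism out of `A_par ⊗ H` is `A_par`-linear, hence determined by its values `f(1 ⊗ x)`. -/
theorem HomObj.apply_tmul {M : PMod.{u, v, w} k H} (f : HomObj (APar k H) M) (a : APar k H)
    (x : H) : f.val (a ⊗ₜ[k] x) =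
      M.aAct a (f.val ((1 : epsAlg (HPar.bracket k H)) ⊗ₜ[k] x)) := by
  rw [map_aAct f, aAct_tmul, mul_one]

/-- `h • f(1 ⊗ y) = ε_{h₍₁₎} · f(1 ⊗ h₍₂₎ y)` -/
theorem HomObj.act_apply_one_tmul {M : PMod.{u, v, w} k H} (f : HomObj (APar k H) M) (h y : H)
    {ι : Type*} (r : Repr k h ι) :
    M.act h (f.val ((1 : epsAlg (HPar.bracket k H)) ⊗ₜ[k] y)) = ∑ i ∈ r.index,
      M.aAct (epsElem (r.left i))
        (f.val ((1 : epsAlg (HPar.bracket k H)) ⊗ₜ[k] (r.right i * y))) := by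
  have h1 := f.prop h ((1 : epsAlg (HPar.bracket k H)) ⊗ₜ[k] y)
  rw [tensor_act_tmul (APar k H) H r, map_sum] at h1
  rw [← h1]
  refine Finset.sum_congr rfl fun i _ => ?_
  rw [← HomObj.apply_tmul, smul_eq_mul]
  congr 2
  exact Subtype.ext (eps_eq_adj _ _).symm

/-! ### Bijectivity of `Ξ` -/

theorem HomObj.ext_one_tmul {M : PMod.{u, v, w} k H} {f : HomObj (APar k H) M}
    (h : ∀ x, f.val ((1 : epsAlg (HPar.bracket k H)) ⊗ₜ[k] x) = 0) : f = 0 := by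
  refine Subtype.ext (TensorProduct.ext' fun a x => ?_)
  rw [f.apply_tmul, h, map_zero]
  rfl

theorem xiApp_injective (M : PMod.{u, v, w} k H) : Function.Injective M.xiApp := by
  intro x y hxy
  refine Subtype.ext (LinearMap.ext fun z => ?_)
  have h1 := congrArg (fun f : HomObj (APar k H) M =>
    f.val ((1 : epsAlg (HPar.bracket k H)) ⊗ₜ[k] z)) hxy
  have h2 (m : M) : M.aAct (1 : epsAlg (HPar.bracket k H)) m = m := by
    change M.parAct 1 m = m
    rw [map_one, Module.End.one_apply]
  exact (h2 _).symm.trans (h1.trans (h2 _))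

theorem HomObj.act_apply_one_tmul_of_isGroupLikeElem {M : PMod.{u, v, w} k H}
    (f : HomObj (APar k H) M) {g : H} (hg : IsGroupLikeElem k g) (y : H) :
    M.act g (f.val ((1 : epsAlg (HPar.bracket k H)) ⊗ₜ[k] y)) =
      M.aAct (epsElem g) (f.val ((1 : epsAlg (HPar.bracket k H)) ⊗ₜ[k] (g * y))) := by
  have := f.act_apply_one_tmul g y (ι := Unit)
    ⟨{()}, fun _ => g, fun _ => g, by simp [hg.comul_eq_tmul_self]⟩
  simpa using this

/-- Modulo the image of `Ξ_M`, every morphism `A_par ⊗ H → M` can be changed so as to vanish at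
`1 ⊗ g` for all `g` in a finite set of grouplike elements. -/
theorem HomObj.exists_sub_mem_range_xiApp {M : PMod.{u, v, w} k H} (f : HomObj (APar k H) M)
    (s : Finset (GroupLike k H)) : ∃ f' : HomObj (APar k H) M,
      f - f' ∈ LinearMap.range M.xiApp ∧
        ∀ g ∈ s, f'.val ((1 : epsAlg (HPar.bracket k H)) ⊗ₜ[k] g.val) = 0 := by
  classical
  induction s using Finset.induction_on with
  | empty => exact ⟨f, by simp, by simp⟩
  | insert g s hgs ih =>
    obtain ⟨f', hf', hs⟩ := ih
    let m := f'.val ((1 : epsAlg (HPar.bracket k H)) ⊗ₜ[k] g.val)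
    let F : M.dilation := (g⁻¹).val • ⟨M.φ m, Submodule.subset_span ⟨m, rfl⟩⟩
    have hF (x : H) : (M.xiApp F).val ((1 : epsAlg (HPar.bracket k H)) ⊗ₜ[k] x) =
        M.act (x * (g⁻¹).val) m := by
      change M.parAct 1 (M.act (x * (g⁻¹).val) m) = _
      rw [map_one, Module.End.one_apply]
    refine ⟨f' - M.xiApp F, ?_, fun g' hg' => ?_⟩
    · have : f - (f' - M.xiApp F) = (f - f') + M.xiApp F := by abel
      rw [this]
      exact add_mem hf' ⟨F, rfl⟩
    · change f'.val _ - (M.xiApp F).val _ = 0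
      rw [hF, sub_eq_zero]
      rcases Finset.mem_insert.1 hg' with rfl | hg'
      · rw [← GroupLike.val_mul, mul_inv_cancel, GroupLike.val_one, M.isPartialRep.map_one]
        rfl
      · rw [hs g' hg', ← GroupLike.val_mul, f'.act_apply_one_tmul_of_isGroupLikeElem
          (g' * g⁻¹).isGroupLikeElem_val, ← GroupLike.val_mul, inv_mul_cancel_right, hs g' hg',
          map_zero]

end CommRing

section Field

variable {k : Type u} {H : Type v} [Field k] [Ring H] [HopfAlgebra k H]

/-- Over a pointed Hopf algebra, a morphism `f : A_par ⊗ H → M` that vanishes at `1 ⊗ g` for all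
grouplike elements `g` is zero. -/
theorem HomObj.eq_zero_of_groupLike (hH : IsPointed k H) {M : PMod.{u, v, w} k H}
    {f : HomObj (APar k H) M}
    (hf : ∀ g : H, IsGroupLikeElem k g →
      f.val ((1 : epsAlg (HPar.bracket k H)) ⊗ₜ[k] g) = 0) : f = 0 := by
  let F : H →ₗ[k] M := f.val ∘ₗ TensorProduct.mk k (APar k H) H (1 : epsAlg (HPar.bracket k H))
  -- The largest left coideal whose translates by grouplike elements lie in the kernel of `F`.
  let W₀ : Submodule k H :=
    { carrier := {h | ∀ (φ : Module.Dual k H) (y : H), IsGroupLikeElem k y →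
        F (leftHit φ h * y) = 0}
      add_mem' := fun ha hb φ y hy => by
        rw [map_add, add_mul, map_add, ha φ y hy, hb φ y hy, add_zero]
      zero_mem' := fun φ y hy => by simp
      smul_mem' := fun c x hx φ y hy => by
        rw [map_smul, smul_mul_assoc, map_smul, hx φ y hy, smul_zero] }
  let W : Submodule (LeftHitAlg k H) H := leftCoideal W₀ fun φ c hc ψ y hy => by
    rw [leftHit_leftHit]
    exact hc _ y hy
  have hWF {h : H} (hh : h ∈ W) {y : H} (hy : IsGroupLikeElem k y) : F (h * y) = 0 := by
    have := hh counit y hy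
    rwa [leftHit_counit] at this
  by_cases hW : W = ⊤
  · refine HomObj.ext_one_tmul fun x => ?_
    have := hWF (hW ▸ Submodule.mem_top : x ∈ W) IsGroupLikeElem.one
    rwa [mul_one] at this
  exfalso
  obtain ⟨h, hhW, g, hg, hgh⟩ := hH.exists_leftHit_sub_smul_mem W hW
  have hzero : ∀ y : H, IsGroupLikeElem k y → F (h * y) = 0 := by
    intro y hy
    let γ : GroupLike k H := ⟨g, hg⟩
    -- `Ψ ∘ Φ` is `a ⊗ b ↦ ε_{a g⁻¹} · F(b y)`; it takes `Δ(h)` to `h g⁻¹ • F(g y) = 0`, and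
    -- `g ⊗ h`, which `Φ` does not distinguish from `Δ(h)`, to `F(h y)`.
    let Φ : H ⊗[k] H →ₗ[k] H ⊗[k] M := (F ∘ₗ LinearMap.mulRight k y).lTensor H
    have hΦ : Φ (comul h) = Φ (g ⊗ₜ h) := by
      rw [← sub_eq_zero, ← map_sub]
      refine eq_zero_of_forall_rTensor _ fun φ => ?_
      have h1 : ∀ z : H ⊗[k] H, TensorProduct.lid k M (φ.rTensor M (Φ z)) =
          F (TensorProduct.lid k H (φ.rTensor H z) * y) := fun z => by
        induction z with
        | zero => simp
        | add y z hy hz => simp only [map_add, hy, hz, add_mul]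
        | tmul a b => simp [Φ]
      rw [h1, map_sub, map_sub]
      exact hWF (hgh φ) hy
    let Ψ : H ⊗[k] M →ₗ[k] M := TensorProduct.lift
      (M.parAct.toLinearMap ∘ₗ eps (HPar.bracket k H) ∘ₗ LinearMap.mulRight k (γ⁻¹).val)
    let r := ℛ k h
    have hr : comul (R := k) (h * (γ⁻¹).val) = ∑ i ∈ r.index,
        (r.left i * (γ⁻¹).val) ⊗ₜ[k] (r.right i * (γ⁻¹).val) := by
      rw [Bialgebra.comul_mul, (γ⁻¹).isGroupLikeElem_val.comul_eq_tmul_self, ← r.eq,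
        Finset.sum_mul]
      simp
    have h1 := f.act_apply_one_tmul (h * (γ⁻¹).val) (g * y)
      ⟨r.index, fun i => r.left i * (γ⁻¹).val, fun i => r.right i * (γ⁻¹).val, hr.symm⟩
    have hγ : (γ⁻¹).val * g = 1 := congrArg GroupLike.val (inv_mul_cancel γ)
    have hγ' : g * (γ⁻¹).val = 1 := congrArg GroupLike.val (mul_inv_cancel γ)
    have hγy (a : H) : a * (γ⁻¹).val * (g * y) = a * y := by
      rw [mul_assoc, ← mul_assoc _ g, hγ, one_mul]
    rw [hf _ (hg.mul hy), map_zero] at h1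
    simp only [hγy] at h1
    have h2 : Ψ (Φ (comul h)) = 0 := by
      rw [h1, ← r.eq, map_sum, map_sum]
      rfl
    rw [hΦ] at h2
    have h3 : Ψ (Φ (g ⊗ₜ h)) = M.aAct (epsElem (g * (γ⁻¹).val)) (F (h * y)) := rfl
    rw [h3, hγ', epsElem_one] at h2
    change M.parAct 1 (F (h * y)) = 0 at h2
    rwa [map_one] at h2
  refine hhW fun φ y hy => ?_
  have h1 := hWF (hgh φ) hy
  rw [sub_mul, map_sub, smul_mul_assoc, map_smul, hzero y hy, smul_zero, sub_zero] at h1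
  exact h1

theorem xiApp_bijective (hH : IsPointed k H) [Finite (GroupLike k H)] (M : PMod.{u, v, w} k H) :
    Function.Bijective M.xiApp := by
  refine ⟨M.xiApp_injective, fun f => ?_⟩
  have := Fintype.ofFinite (GroupLike k H)
  obtain ⟨f', hf', hz⟩ := f.exists_sub_mem_range_xiApp Finset.univ
  have h0 : f' = 0 := HomObj.eq_zero_of_groupLike hH fun g hg => hz ⟨g, hg⟩ (Finset.mem_univ _)
  rwa [h0, sub_zero] at hf'

end Field
end PMod
end PartialHopf
end

theorem mainTheorem1 {k : Type u} {H : Type v} [Field k] [CharZero k] [Ring H] [HopfAlgebra k H]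
    (hH : PartialHopf.IsPointed k H) [Finite (GroupLike k H)] :
    CategoryTheory.IsIso (PartialHopf.PMod.xi.{u, v, w} k H) ∧
      Nonempty (PartialHopf.PMod.dilationFunctor.{u, v, w} k H ≅
        PartialHopf.PMod.homAParFunctor.{u, v, w} k H) ∧
      ∀ M : PartialHopf.PMod.{u, v, w'} k H,
        ∃ e : M.dilation ≃ₗ[H] PartialHopf.PMod.HomObj (PartialHopf.PMod.APar k H) M,
          e.toLinearMap = M.xiApp := by
  have hiso : CategoryTheory.IsIso (PartialHopf.PMod.xi.{u, v, w} k H) := by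
    rw [CategoryTheory.NatTrans.isIso_iff_isIso_app]
    intro M
    rw [CategoryTheory.ConcreteCategory.isIso_iff_bijective]
    exact PartialHopf.PMod.xiApp_bijective hH M
  exact ⟨hiso, ⟨CategoryTheory.asIso (PartialHopf.PMod.xi.{u, v, w} k H)⟩,
    fun M => ⟨LinearEquiv.ofBijective M.xiApp (PartialHopf.PMod.xiApp_bijective hH M), rfl⟩⟩
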